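/- **Setting.** Let $\mathcal A,\mathcal B$ be unital $C^*$-algebras and $\phi_1,\phi_2:\mathcal A\to\mathcal B$ unital completely positive (UCP) maps. A *joint representation tuple* $(\mathcal E,\sigma_1,\sigma_2,x)$ of $(\phi_1,\phi_2)$ is a (right) Hilbert $\mathcal B$-module $\mathcal E$ with two unital left actions $\sigma_1,\sigma_2$ of $\mathcal A$ by adjointable operators and a vector $x\in\mathcal E$ with $\langle x,x\rangle=1$ and $\phi_i(a)=\langle x,\sigma_i(a)x\rangle$ ($a\in\mathcal A$, $i=1,2$); put $\gamma(\phi_1,\phi_2)=\inf\|\sigma_1-\sigma_2\|_{cb}$ over all such tuples. A *common representation tuple* $(\mathcal E,\sigma,x_1,x_2)$ is a Hilbert $\mathcal B$-module with one unital left action $\sigma$ of $\mathcal A$ and vectors $x_1,x_2$ with $\phi_i(a)=\langle x_i,\sigma(a)x_i\rangle$; the Bures distance is $\beta(\phi_1,\phi_2)=\inf\|x_1-x_2\|$ over all such tuples. **Statement.** Let $H$ be a separable infinite-dimensional complex Hilbert space, $\mathcal K$ the compact operators on $H$, $\mathcal K_+=\operatorname{span}\{\mathcal K,\mathbb C I_H\}$,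 and $$\mathcal A=\begin{pmatrix}\mathcal K_+&\mathcal K\\ \mathcal K&\mathcal K_+\end{pmatrix}\subset\mathcal B(H\oplus H),\qquad \mathcal B=\mathcal K_+ .$$ Let $p$ be an orthogonal projection on $H$ such that $p$ and $1-p$ both have infinite-dimensional range, let $0<\theta<\pi/4$, and put $$u=e^{i\theta}p+e^{-i\theta}(1-p),\qquad z_1=\tfrac1{\sqrt2}\begin{pmatrix}I\\ I\end{pmatrix},\qquad z_2=\tfrac1{\sqrt2}\begin{pmatrix}u\\ I\end{pmatrix},\qquad \phi_i(a)=z_i^*az_i\quad(a\in\mathcal A,\ i=1,2).$$ Let $\iota:\mathcal B\to\mathcal B(H)$ be the inclusion. Then $\mathcal B$ is not injective (there is no completely positive projection of $\mathcal B(H)$ onto $\mathcal B$), $\phi_1,\phi_2$ are UCP maps from $\mathcal A$ to $\mathcal B$, and $$2\sin\theta\;\ge\;\gamma(\phi_1,\phi_2)\;\ge\;\frac{2\sin\theta}{\sqrt{1+\sin^2\theta}}\;>\;\gamma(\iota\circ\phi_1,\iota\circ\phi_2),$$ where $$\beta(\iota\circ\phi_1,\iota\circ\phi_2)=\sqrt{1-\cos\theta},\qquad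 \gamma(\iota\circ\phi_1,\iota\circ\phi_2)=\sqrt{(3+\cos\theta)(1-\cos\theta)} .$$ In particular $\gamma(\phi_1,\phi_2)\ne\gamma(\iota\circ\phi_1,\iota\circ\phi_2)$. Moreover $\beta(\phi_1,\phi_2)=\sqrt2$, and $$\gamma(\phi_1,\phi_2)\ne\beta(\phi_1,\phi_2)\sqrt{4-\beta^2(\phi_1,\phi_2)} .$$ -/

import Mathlib

open scoped ENNReal

universe u

set_option linter.unusedSectionVars false

/-! ### Hilbert modules, left actions and the two distances -/

/-- A (right) Hilbert `B`-module over the C⋆-algebra `B`; the right action of `b` is `op b • x`.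
The `B`-valued inner product is `B`-linear in the second variable, `⟨x, y b⟩ = ⟨x, y⟩ b`, and it
induces the norm of `E`, which is complete. (Mathlib's `CStarModule` is linear for a left action,
`⟨x, b y⟩ = b ⟨x, y⟩`, so it is not used here.) -/
class HilbertModule (B E : Type u) [CStarAlgebra B] [PartialOrder B]
    [NormedAddCommGroup E] [NormedSpace ℂ E] [Module Bᵐᵒᵖ E] extends Inner B E where
  inner_add_right : ∀ x y z : E, inner x (y + z) = inner x y + inner x z
  inner_smul_right : ∀ (c : ℂ) (x y : E), inner x (c • y) = c • inner x y
  inner_op_smul_right : ∀ (b : B) (x y : E), inner x (MulOpposite.op b • y) = inner x y * b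
  star_inner : ∀ x y : E, star (inner x y) = inner y x
  inner_self_nonneg : ∀ x : E, 0 ≤ inner x x
  norm_sq_eq : ∀ x : E, ‖x‖ ^ 2 = ‖inner x x‖
  complete : CompleteSpace E

/-- A unital left action of `A` on the Hilbert `B`-module `E`: a unital ⋆-homomorphism from `A`
to the bounded adjointable operators on `E`, the adjoint of the operator `a` being that of
`star a`. Right `B`-linearity follows from adjointability. -/
structure LeftAction (A B E : Type u) [CStarAlgebra A] [CStarAlgebra B] [PartialOrder B]
    [NormedAddCommGroup E] [NormedSpace ℂ E] [Module Bᵐᵒᵖ E] [HilbertModule B E]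
    extends A →ₐ[ℂ] (E →L[ℂ] E) where
  inner_map_left : ∀ (a : A) (x y : E),
    inner B (toAlgHom a x) y = inner B x (toAlgHom (star a) y)

section Modules

variable {A B : Type u} [CStarAlgebra A] [PartialOrder A] [StarOrderedRing A]
  [CStarAlgebra B] [PartialOrder B] [StarOrderedRing B]

/-- The norm of the Hilbert `B`-module `E ^ n`: `‖(x_i)‖² = ‖∑ i, ⟨x_i, x_i⟩‖`. -/
noncomputable def tupleNorm (B : Type u) [CStarAlgebra B] [PartialOrder B] {E : Type u}
    [NormedAddCommGroup E] [NormedSpace ℂ E] [Module Bᵐᵒᵖ E] [HilbertModule B E]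
    {n : ℕ} (x : Fin n → E) : ℝ :=
  √‖∑ i, inner B (x i) (x i)‖

/-- The completely bounded norm of a map `D` from `A` to the operators on the Hilbert `B`-module
`E`: the supremum over `n` of the norms of the ampliations of `D` from `M_n(A)` (with its
C⋆-norm) to the operators on `E ^ n`. -/
noncomputable def cbNorm (B : Type u) [CStarAlgebra B] [PartialOrder B] {E : Type u}
    [NormedAddCommGroup E] [NormedSpace ℂ E] [Module Bᵐᵒᵖ E] [HilbertModule B E]
    (D : A → (E →L[ℂ] E)) : ℝ≥0∞ :=
  ⨆ (n : ℕ) (a : CStarMatrix (Fin n) (Fin n) A) (_ : ‖a‖ ≤ 1)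
    (x : Fin n → E) (_ : tupleNorm B x ≤ 1),
    ENNReal.ofReal (tupleNorm B fun i => ∑ j, D (a i j) (x j))

/-- Unital completely positive maps. -/
def IsUCP (φ : A →ₗ[ℂ] B) : Prop :=
  φ 1 = 1 ∧ ∃ ψ : CompletelyPositiveMap A B, ψ.toLinearMap = φ

/-- Joint representation tuples `(E, σ₁, σ₂, x)`: one vector, two left actions. -/
structure JointRep (φ₁ φ₂ : A →ₗ[ℂ] B) where
  E : Type u
  [normedAddCommGroup : NormedAddCommGroup E]
  [normedSpace : NormedSpace ℂ E]
  [module : Module Bᵐᵒᵖ E]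
  [hilbertModule : HilbertModule B E]
  σ₁ : LeftAction A B E
  σ₂ : LeftAction A B E
  x : E
  inner_self : inner B x x = 1
  map₁ : ∀ a, φ₁ a = inner B x (σ₁.toAlgHom a x)
  map₂ : ∀ a, φ₂ a = inner B x (σ₂.toAlgHom a x)

/-- Common representation tuples `(E, σ, x₁, x₂)`: one left action, two vectors. -/
structure CommonRep (φ₁ φ₂ : A →ₗ[ℂ] B) where
  E : Type u
  [normedAddCommGroup : NormedAddCommGroup E]
  [normedSpace : NormedSpace ℂ E]
  [module : Module Bᵐᵒᵖ E]
  [hilbertModule : HilbertModule B E]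
  σ : LeftAction A B E
  x₁ : E
  x₂ : E
  map₁ : ∀ a, φ₁ a = inner B x₁ (σ.toAlgHom a x₁)
  map₂ : ∀ a, φ₂ a = inner B x₂ (σ.toAlgHom a x₂)

attribute [instance] JointRep.normedAddCommGroup JointRep.normedSpace JointRep.module
  JointRep.hilbertModule CommonRep.normedAddCommGroup CommonRep.normedSpace CommonRep.module
  CommonRep.hilbertModule

/-- The representation metric `γ(φ₁, φ₂) = inf ‖σ₁ - σ₂‖_cb` over joint representation tuples. -/
noncomputable def repMetric (φ₁ φ₂ : A →ₗ[ℂ] B) : ℝ≥0∞ :=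
  ⨅ R : JointRep φ₁ φ₂, cbNorm B fun a => R.σ₁.toAlgHom a - R.σ₂.toAlgHom a

/-- The Bures distance `β(φ₁, φ₂) = inf ‖x₁ - x₂‖` over common representation tuples. -/
noncomputable def buresDist (φ₁ φ₂ : A →ₗ[ℂ] B) : ℝ≥0∞ :=
  ⨅ R : CommonRep φ₁ φ₂, ENNReal.ofReal ‖R.x₁ - R.x₂‖

end Modules

/-! ### Closed ⋆-subalgebras as ordered C⋆-algebras -/

theorem starOrderedRing_of_isClosed {R : Type u} [CStarAlgebra R] [PartialOrder R]
    [StarOrderedRing R] (S : StarSubalgebra ℂ R) (hS : IsClosed (S : Set R)) :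
    StarOrderedRing S := by
  have hcl : IsClosed (S : Set R) := hS
  refine StarOrderedRing.of_nonneg_iff' (fun {x y} hxy z => ?_) (fun x => ⟨fun hx => ?_, ?_⟩)
  · exact add_le_add_right (show (x : R) ≤ y from hxy) (z : R)
  · have hx' : (0 : R) ≤ (x : R) := hx
    have hsa : IsSelfAdjoint x := Subtype.ext (IsSelfAdjoint.of_nonneg hx').star_eq
    have hsp : QuasispectrumRestricts x ContinuousMap.realToNNReal := by
      rw [quasispectrumRestricts_iff_spectrumRestricts, SpectrumRestricts.nnreal_iff]
      intro r hr
      refine spectrum_nonneg_of_nonneg hx' (fun hu => hr ?_)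
      exact (StarSubalgebra.coe_isUnit S (a := algebraMap ℝ S r - x)).1 hu
    obtain ⟨s, hs₁, _, hs₂⟩ :=
      CFC.exists_sqrt_of_isSelfAdjoint_of_quasispectrumRestricts hsa hsp
    exact ⟨s, by rw [hs₁.star_eq, hs₂]⟩
  · rintro ⟨s, rfl⟩
    exact star_mul_self_nonneg (s : R)

/-! ### The algebras `𝒦₊` and `𝒜` -/

section Operators

variable {H : Type u} [NormedAddCommGroup H] [InnerProductSpace ℂ H] [CompleteSpace H]

theorem isCompactOperator_adjoint {T : H →L[ℂ] H} (hT : IsCompactOperator T) :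
    IsCompactOperator (ContinuousLinearMap.adjoint T) := by
  set T' := ContinuousLinearMap.adjoint T
  have hc : IsCompactOperator (T ∘L T') := hT.comp_clm T'
  have key : ∀ x y : H, ‖T' x - T' y‖ ^ 2 ≤ ‖(T ∘L T') x - (T ∘L T') y‖ * ‖x - y‖ := by
    intro x y
    rw [← map_sub, ← map_sub]
    calc ‖T' (x - y)‖ ^ 2 = ‖inner ℂ (T (T' (x - y))) (x - y)‖ := by
          rw [← ContinuousLinearMap.adjoint_inner_right, inner_self_eq_norm_sq_to_K]
          simp
      _ ≤ _ := norm_inner_le_norm _ _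
  refine (isCompactOperator_iff_isCompact_closure_image_ball
    (T' : H →ₗ[ℂ] H) one_pos).2 ?_
  refine TotallyBounded.isCompact_of_isClosed (TotallyBounded.closure ?_) isClosed_closure
  have htb : TotallyBounded ((T ∘L T') '' Metric.ball 0 1) :=
    (IsCompactOperator.isCompact_closure_image_ball (f := ((T ∘L T' : H →L[ℂ] H) : H →ₗ[ℂ] H))
      hc 1).totallyBounded.subset subset_closure
  refine Metric.totallyBounded_iff.2 fun ε hε => ?_
  obtain ⟨t, hts, htf, hcov⟩ := (totallyBounded_iff_subset.1 htb) _
    (Metric.dist_mem_uniformity (show 0 < ε ^ 2 / 2 by positivity))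
  have hts' : ∀ y ∈ t, ∃ x ∈ Metric.ball (0 : H) 1, (T ∘L T') x = y := hts
  choose! g hg using hts'
  refine ⟨(fun y => T' (g y)) '' t, htf.image _, ?_⟩
  rintro _ ⟨x, hx, rfl⟩
  obtain ⟨y, hy, hxy⟩ := Set.mem_iUnion₂.1 (hcov (Set.mem_image_of_mem _ hx))
  refine Set.mem_iUnion₂.2 ⟨_, Set.mem_image_of_mem _ hy, ?_⟩
  have h1 := key x (g y)
  rw [(hg y hy).2, ← dist_eq_norm ((T ∘L T') x) y] at h1
  have hxy' : dist ((T ∘L T') x) y < ε ^ 2 / 2 := hxy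
  have h2 : ‖x - g y‖ ≤ 2 := by
    have hx' := mem_ball_zero_iff.1 hx
    have hg' := mem_ball_zero_iff.1 (hg y hy).1
    linarith [norm_sub_le x (g y)]
  have h3 : ‖T' x - T' (g y)‖ ^ 2 < ε ^ 2 := by
    nlinarith [dist_nonneg (x := (T ∘L T') x) (y := y), norm_nonneg (x - g y)]
  change dist (T' x) (T' (g y)) < ε
  rw [dist_eq_norm]
  exact lt_of_pow_lt_pow_left₀ 2 hε.le h3

/-- `𝒦₊ = span {𝒦, ℂ I}`: compact operators plus scalars. -/
noncomputable def kPlus (H : Type u) [NormedAddCommGroup H] [InnerProductSpace ℂ H]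
    [CompleteSpace H] : StarSubalgebra ℂ (H →L[ℂ] H) where
  carrier := {T | ∃ (K : H →L[ℂ] H) (c : ℂ), IsCompactOperator K ∧ T = K + c • 1}
  mul_mem' := by
    rintro _ _ ⟨K, c, hK, rfl⟩ ⟨L, d, hL, rfl⟩
    refine ⟨K * (L + d • 1) + c • L, c * d, ?_, ?_⟩
    · exact (hK.comp_clm (L + d • 1)).add (hL.smul c)
    · simp only [add_mul, mul_add, smul_mul_assoc, one_mul, mul_smul_comm, mul_one, smul_add,
        smul_smul, mul_comm]
      abel
  add_mem' := by
    rintro _ _ ⟨K, c, hK, rfl⟩ ⟨L, d, hL, rfl⟩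
    exact ⟨K + L, c + d, hK.add hL, by rw [add_smul]; abel⟩
  algebraMap_mem' c := ⟨0, c, isCompactOperator_zero, by simp [Algebra.algebraMap_eq_smul_one]⟩
  star_mem' := by
    rintro _ ⟨K, c, hK, rfl⟩
    exact ⟨star K, star c, isCompactOperator_adjoint hK, by simp⟩

theorem mem_kPlus {T : H →L[ℂ] H} :
    T ∈ kPlus H ↔ ∃ (K : H →L[ℂ] H) (c : ℂ), IsCompactOperator K ∧ T = K + c • 1 :=
  Iff.rfl

theorem mem_kPlus_of_compact {T : H →L[ℂ] H} (hT : IsCompactOperator T) : T ∈ kPlus H :=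
  ⟨T, 0, hT, by simp⟩

instance isClosed_kPlus : IsClosed (kPlus H : Set (H →L[ℂ] H)) := by
  have h := Submodule.isClosed_sup_finiteDimensional
    (compactOperator (RingHom.id ℂ) H H) (Submodule.span ℂ {(1 : H →L[ℂ] H)})
    isClosed_setOfPred_isCompactOperator
  convert h using 1
  ext T
  simp only [SetLike.mem_coe, mem_kPlus, Submodule.mem_sup, Submodule.mem_span_singleton]
  constructor
  · rintro ⟨K, c, hK, rfl⟩
    exact ⟨K, hK, _, ⟨c, rfl⟩, rfl⟩
  · rintro ⟨K, hK, _, ⟨c, rfl⟩, rfl⟩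
    exact ⟨K, c, hK, rfl⟩

instance starOrderedRing_kPlus : StarOrderedRing (kPlus H) :=
  starOrderedRing_of_isClosed _ isClosed_kPlus

/-- The Hilbert space direct sum `H ⊕ H`. -/
abbrev HSum (H : Type u) [NormedAddCommGroup H] [InnerProductSpace ℂ H] : Type u :=
  WithLp 2 (H × H)

/-- The column operator `h ↦ (S h, T h)` from `H` to `H ⊕ H`. -/
noncomputable def column (S T : H →L[ℂ] H) : H →L[ℂ] HSum H :=
  (WithLp.prodContinuousLinearEquiv 2 ℂ H H).symm.toContinuousLinearMap ∘L S.prod T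

/-- The `j`-th coordinate embedding of `H` into `H ⊕ H`. -/
noncomputable def coordIncl (H : Type u) [NormedAddCommGroup H] [InnerProductSpace ℂ H]
    (j : Fin 2) : H →L[ℂ] HSum H :=
  if j = 0 then column 1 0 else column 0 1

/-- The `i`-th coordinate projection of `H ⊕ H` onto `H`. -/
noncomputable def coordProj (H : Type u) [NormedAddCommGroup H] [InnerProductSpace ℂ H]
    (i : Fin 2) : HSum H →L[ℂ] H :=
  if i = 0 then WithLp.fstL 2 ℂ H H else WithLp.sndL 2 ℂ H H

/-- The entry `T i j` of an operator `T` on `H ⊕ H`, seen as a 2 × 2 operator matrix. -/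
noncomputable def entry (i j : Fin 2) (T : HSum H →L[ℂ] HSum H) : H →L[ℂ] H :=
  coordProj H i ∘L T ∘L coordIncl H j

theorem entry_one (i j : Fin 2) : entry i j (1 : HSum H →L[ℂ] HSum H) = if i = j then 1 else 0 := by
  ext h
  fin_cases i <;> fin_cases j <;> simp [entry, coordProj, coordIncl, column]

theorem entry_add (i j : Fin 2) (S T : HSum H →L[ℂ] HSum H) :
    entry i j (S + T) = entry i j S + entry i j T := by
  simp [entry]

theorem entry_smul (i j : Fin 2) (c : ℂ) (T : HSum H →L[ℂ] HSum H) :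
    entry i j (c • T) = c • entry i j T := by
  simp [entry]

theorem entry_mul (i j : Fin 2) (S T : HSum H →L[ℂ] HSum H) :
    entry i j (S * T) = entry i 0 S * entry 0 j T + entry i 1 S * entry 1 j T := by
  ext h
  have : T (coordIncl H j h) = coordIncl H 0 (coordProj H 0 (T (coordIncl H j h)))
      + coordIncl H 1 (coordProj H 1 (T (coordIncl H j h))) := by
    generalize T (coordIncl H j h) = y
    apply (WithLp.equiv 2 (H × H)).injective
    ext <;> simp [coordProj, coordIncl, column]
  simp only [entry, ContinuousLinearMap.comp_apply, mul_apply_eq_comp,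
    add_apply]
  rw [← map_add, ← map_add, ← this]

theorem adjoint_coordIncl (j : Fin 2) :
    ContinuousLinearMap.adjoint (coordIncl H j) = coordProj H j := by
  symm
  rw [ContinuousLinearMap.eq_adjoint_iff]
  intro x y
  fin_cases j <;> simp [coordProj, coordIncl, column, WithLp.prod_inner_apply]

theorem entry_star (i j : Fin 2) (T : HSum H →L[ℂ] HSum H) :
    entry i j (star T) = star (entry j i T) := by
  simp only [entry, ContinuousLinearMap.star_eq_adjoint, ContinuousLinearMap.adjoint_comp,
    ← adjoint_coordIncl, ContinuousLinearMap.adjoint_adjoint, ContinuousLinearMap.comp_assoc]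

/-- `𝒜`: the operators on `H ⊕ H` whose diagonal entries are in `𝒦₊` and whose off-diagonal
entries are compact. -/
noncomputable def matAlg (H : Type u) [NormedAddCommGroup H] [InnerProductSpace ℂ H]
    [CompleteSpace H] : StarSubalgebra ℂ (HSum H →L[ℂ] HSum H) where
  carrier := {T | entry 0 0 T ∈ kPlus H ∧ IsCompactOperator (entry 0 1 T) ∧
    IsCompactOperator (entry 1 0 T) ∧ entry 1 1 T ∈ kPlus H}
  mul_mem' := by
    rintro S T ⟨s1, s2, s3, s4⟩ ⟨t1, t2, t3, t4⟩
    simp only [Set.mem_ofPred_eq, entry_mul]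
    exact ⟨add_mem (mul_mem s1 t1) (mem_kPlus_of_compact (s2.comp_clm _)),
      (t2.clm_comp (entry 0 0 S)).add (s2.comp_clm _),
      (s3.comp_clm (entry 0 0 T)).add (t3.clm_comp (entry 1 1 S)),
      add_mem (mem_kPlus_of_compact (s3.comp_clm _)) (mul_mem s4 t4)⟩
  add_mem' := by
    rintro S T ⟨s1, s2, s3, s4⟩ ⟨t1, t2, t3, t4⟩
    simp only [Set.mem_ofPred_eq, entry_add]
    exact ⟨add_mem s1 t1, s2.add t2, s3.add t3, add_mem s4 t4⟩
  algebraMap_mem' c := by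
    simp only [Set.mem_ofPred_eq, Algebra.algebraMap_eq_smul_one, entry_smul, entry_one]
    refine ⟨?_, ?_, ?_, ?_⟩
    · simpa using (kPlus H).smul_mem (one_mem _) c
    · simpa using isCompactOperator_zero
    · simpa using isCompactOperator_zero
    · simpa using (kPlus H).smul_mem (one_mem _) c
  star_mem' := by
    rintro T ⟨t1, t2, t3, t4⟩
    simp only [Set.mem_ofPred_eq, entry_star]
    exact ⟨star_mem t1, isCompactOperator_adjoint t3, isCompactOperator_adjoint t2, star_mem t4⟩

theorem continuous_entry (i j : Fin 2) :
    Continuous (entry i j : (HSum H →L[ℂ] HSum H) → (H →L[ℂ] H)) := by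
  unfold entry
  fun_prop

instance isClosed_matAlg : IsClosed (matAlg H : Set (HSum H →L[ℂ] HSum H)) := by
  have hK : IsClosed {T : H →L[ℂ] H | IsCompactOperator T} := isClosed_setOfPred_isCompactOperator
  exact (isClosed_kPlus.preimage (continuous_entry 0 0)).inter
    ((hK.preimage (continuous_entry 0 1)).inter
      ((hK.preimage (continuous_entry 1 0)).inter
        (isClosed_kPlus.preimage (continuous_entry 1 1))))

instance starOrderedRing_matAlg : StarOrderedRing (matAlg H) :=
  starOrderedRing_of_isClosed _ isClosed_matAlg

/-- A unital C⋆-algebra of operators on `H` is injective if it is the range of a completely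
positive projection of `B(H)`. -/
def IsInjectiveAlgebra (S : StarSubalgebra ℂ (H →L[ℂ] H)) [IsClosed (S : Set (H →L[ℂ] H))]
    [StarOrderedRing S] : Prop :=
  ∃ Φ : CompletelyPositiveMap (H →L[ℂ] H) S, ∀ b : S, Φ (b : H →L[ℂ] H) = b

/-! ### The maps `φ₁`, `φ₂` -/

/-- The column `z = (u, I) / √2`. -/
noncomputable def zCol (u : H →L[ℂ] H) : H →L[ℂ] HSum H :=
  ((√2 : ℝ) : ℂ)⁻¹ • column u 1

theorem zCol_compression_mem {u : H →L[ℂ] H} (hu : star u * u = 1) {a : HSum H →L[ℂ] HSum H}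
    (ha : a ∈ matAlg H) : ContinuousLinearMap.adjoint (zCol u) ∘L a ∘L zCol u ∈ kPlus H := by
  have hcol : column u 1 = coordIncl H 0 ∘L u + coordIncl H 1 := by
    ext h
    apply (WithLp.equiv 2 (H × H)).injective
    ext <;> simp [coordIncl, column]
  have hz : ContinuousLinearMap.adjoint (column u 1) ∘L a ∘L column u 1 =
      star u * entry 0 0 a * u + star u * entry 0 1 a + entry 1 0 a * u + entry 1 1 a := by
    rw [hcol]
    simp only [map_add, ContinuousLinearMap.adjoint_comp, adjoint_coordIncl]
    ext h
    simp [entry, ContinuousLinearMap.star_eq_adjoint]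
    abel
  obtain ⟨⟨K, c, hK, h00⟩, h01, h10, h11⟩ := ha
  have hmem : ContinuousLinearMap.adjoint (column u 1) ∘L a ∘L column u 1 ∈ kPlus H := by
    rw [hz, h00]
    refine add_mem (add_mem (add_mem ?_ (mem_kPlus_of_compact (h01.clm_comp (star u))))
      (mem_kPlus_of_compact (h10.comp_clm u))) h11
    refine ⟨star u * K * u, c, (hK.clm_comp (star u)).comp_clm u, ?_⟩
    simp [mul_add, add_mul, hu]
  have := (kPlus H).smul_mem ((kPlus H).smul_mem hmem ((√2 : ℝ) : ℂ)⁻¹)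
    (star ((√2 : ℝ) : ℂ)⁻¹)
  convert this using 1
  rw [zCol, map_smulₛₗ, ContinuousLinearMap.comp_smul, ContinuousLinearMap.comp_smul,
    ContinuousLinearMap.smul_comp,
    smul_comm]
  rfl

/-- The map `φ(a) = z⋆ a z` from `𝒜` to `𝒦₊`, where `z = (u, I) / √2` and `u` is an isometry. -/
noncomputable def phiMap (u : H →L[ℂ] H) (hu : star u * u = 1) : matAlg H →ₗ[ℂ] kPlus H where
  toFun a := ⟨ContinuousLinearMap.adjoint (zCol u) ∘L (a : HSum H →L[ℂ] HSum H) ∘L zCol u,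
    zCol_compression_mem hu a.2⟩
  map_add' a b := by ext; simp
  map_smul' c a := by ext; simp

/-- `u = e^{iθ} p + e^{-iθ} (1 - p)`. -/
noncomputable def phaseOp (p : H →L[ℂ] H) (θ : ℝ) : H →L[ℂ] H :=
  Complex.exp (θ * Complex.I) • p + Complex.exp (-(θ * Complex.I)) • (1 - p)

theorem phaseOp_isometry {p : H →L[ℂ] H} (hp : IsStarProjection p) (θ : ℝ) :
    star (phaseOp p θ) * phaseOp p θ = 1 := by
  have h1 : p * p = p := hp.isIdempotentElem
  have h2 : star p = p := hp.isSelfAdjoint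
  have e1 : star (Complex.exp (θ * Complex.I)) = Complex.exp (-(θ * Complex.I)) := by
    simp [← Complex.exp_conj]
  have e2 : star (Complex.exp (-(θ * Complex.I))) = Complex.exp (θ * Complex.I) := by
    simp [← Complex.exp_conj]
  have e3 : Complex.exp (θ * Complex.I) * Complex.exp (-(θ * Complex.I)) = 1 := by
    rw [← Complex.exp_add]; simp
  rw [phaseOp, star_add, star_smul, star_smul, star_sub, star_one, h2, e1, e2]
  generalize Complex.exp (θ * Complex.I) = c at e3
  generalize Complex.exp (-(θ * Complex.I)) = d at e3
  have h3 : (d • p + c • (1 - p)) * (c • p + d • (1 - p)) = (c * d) • (1 : H →L[ℂ] H) := by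
    have h4 : p * (1 - p) = 0 := by rw [mul_sub, mul_one, h1, sub_self]
    have h5 : (1 - p) * p = 0 := by rw [sub_mul, one_mul, h1, sub_self]
    have h6 : (1 - p) * (1 - p) = 1 - p := by rw [mul_sub, h5, mul_one, sub_zero]
    rw [add_mul, mul_add, mul_add, smul_mul_smul_comm, smul_mul_smul_comm, smul_mul_smul_comm,
      smul_mul_smul_comm, h1, h4, h5, h6]
    module
  rw [h3, e3, one_smul]

end Operators

/-! All estimates rest on one dictionary. If `⟨x, σ(a) x⟩ = z⋆ τ(a) z`, then `σ(a) x b ↦ τ(a) z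
π(b)` preserves inner products, so the submodule generated by `x` can be computed inside the
operators from `H` to `H ⊕ H`. Since `B` contains the rank one operators, right multiplication by
`|w⟩⟨h|` localises at the vector `z w`. `OperatorRep` and `Represents` set this up for `𝒦₊` and
`B(H)` at once.

Upper bounds for `γ`: a representation and its conjugate by a unitary `C` differ by at most `2 ‖C -
l‖` in cb norm, for every scalar `l`. Over `B(H)` every unitary with `C⋆ z₁ = z₂` is admissible, and
`rotOp` is one with scalar real part `(1 + cos θ)/2`. Over `𝒦₊` the conjugated action must preserve
the columns with entries in `𝒦₊`. The unitary `diag(u⋆, 1)` does this because the off-diagonal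
entries of `𝒜` are compact, and it gives `2 sin θ`.

Lower bounds for `γ`: if a projection `q` satisfies `σ₂(q) y = 0` with `‖y‖ ≤ 1`, the unitary `2q -
1` shows that the cb norm is at least `2 ‖σ₁(q) y‖`. For any `B`, the choice `y = x |h⟩⟨h|`, `q = 1
- |z₂ h⟩⟨z₂ h|` with `⟨h, u h⟩ = cos θ` gives the `B(H)` value (`le_cbNorm_of_inner_eq`). Over `𝒦₊`
more is true: with `e₀` the first diagonal unit, `2 ⟨σ₁(e₀) x, σ₂(e₀) x⟩` lies in `𝒦₊`, hence equals
`K + t` with `K` compact and `t` scalar. A unit vector `h`, mixed equally from the ranges of `p` and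
`1 - p`, can be chosen so that `K` almost kills `u⋆ h`. Testing at `y = √2 σ₂(e₀) x |u⋆ h⟩⟨h|` gives
`‖σ₁(q) y‖² ≥ |t|² sin² θ + |1 - t|²` up to a small error (`exists_le_cbNorm`), and the minimum of
the right side over `t` is `sin² θ / (1 + sin² θ)`.

Bures distance: the off-diagonal rank one elements of `𝒜` force `⟨x₁, x₂⟩ = l (u + 1)` with `l u` in
the range of `B` (`exists_map_inner_eq`). Over `𝒦₊` this gives `l = 0`, since `u` is not scalar
modulo compacts, so `x₁` and `x₂` are orthogonal and `β = √2`. Over `B(H)` only `Re l ≤ 1/2`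
remains. Finally `β √(4 - β²) = 2 > 2 sin θ`. -/

/-! ### Hilbert modules -/

section HilbertModuleLemmas

variable {A B E : Type u} [CStarAlgebra A] [PartialOrder A] [StarOrderedRing A]
  [CStarAlgebra B] [PartialOrder B] [NormedAddCommGroup E] [NormedSpace ℂ E]
  [Module Bᵐᵒᵖ E] [HilbertModule B E]

namespace HilbertModule

theorem inner_add_left (x y z : E) : inner B (x + y) z = inner B x z + inner B y z := by
  rw [← star_inner z, inner_add_right, star_add, star_inner, star_inner]

theorem inner_op_smul_left (b : B) (x y : E) :
    inner B (MulOpposite.op b • x) y = star b * inner B x y := by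
  rw [← star_inner y, inner_op_smul_right, star_mul, star_inner]

theorem inner_sub_right (x y z : E) : inner B x (y - z) = inner B x y - inner B x z := by
  rw [eq_sub_iff_add_eq, ← inner_add_right, sub_add_cancel]

theorem inner_sub_left (x y z : E) : inner B (x - y) z = inner B x z - inner B y z := by
  rw [eq_sub_iff_add_eq, ← inner_add_left, sub_add_cancel]

theorem eq_zero_of_inner_self {x : E} (h : inner B x x = 0) : x = 0 := by
  have := norm_sq_eq (B := B) x
  rw [h, norm_zero] at this
  exact norm_eq_zero.1 (pow_eq_zero_iff two_ne_zero |>.1 this)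

theorem ext_inner {x y : E} (h : ∀ z : E, inner B z x = inner B z y) : x = y :=
  sub_eq_zero.1 <| eq_zero_of_inner_self (B := B) <| by rw [inner_sub_right, h, sub_self]

theorem tupleNorm_const (x : E) : tupleNorm B (fun _ : Fin 1 => x) = ‖x‖ := by
  rw [tupleNorm, Fin.sum_univ_one, ← norm_sq_eq, Real.sqrt_sq (norm_nonneg x)]

end HilbertModule

open HilbertModule

theorem LeftAction.map_op_smul (σ : LeftAction A B E) (a : A) (b : B) (x : E) :
    σ.toAlgHom a (MulOpposite.op b • x) = MulOpposite.op b • σ.toAlgHom a x := by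
  refine ext_inner (B := B) fun z => ?_
  have h := σ.inner_map_left (star a) z
  simp only [star_star] at h
  rw [← h, inner_op_smul_right, inner_op_smul_right, h]

/-- A unitary element bounds the completely bounded norm from below. -/
theorem norm_le_cbNorm_of_unitary (D : A → (E →L[ℂ] E)) {t : A} (ht : star t * t = 1) {y : E}
    (hy : ‖y‖ ≤ 1) : ENNReal.ofReal ‖D t y‖ ≤ cbNorm B D := by
  let a : CStarMatrix (Fin 1) (Fin 1) A := CStarMatrix.ofMatrix fun _ _ => t
  have haa : star a * a = 1 := by
    ext i j
    rw [CStarMatrix.mul_apply, Fin.sum_univ_one, CStarMatrix.star_apply]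
    obtain rfl := Subsingleton.elim i j
    rw [CStarMatrix.one_apply_eq]
    obtain rfl := Subsingleton.elim i 0
    exact ht
  have ha : ‖a‖ ≤ 1 := by
    have h1 := CStarRing.norm_star_mul_self (x := a)
    rw [haa] at h1
    rcases subsingleton_or_nontrivial (CStarMatrix (Fin 1) (Fin 1) A) with h | h
    · rw [Subsingleton.elim a 0, norm_zero]; exact zero_le_one
    · rw [CStarRing.norm_one] at h1
      nlinarith [norm_nonneg a]
  unfold cbNorm
  refine le_iSup_of_le 1 <| le_iSup_of_le a <| le_iSup_of_le ha <| le_iSup_of_le (fun _ => y) <|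
    le_iSup_of_le (by rwa [tupleNorm_const]) ?_
  refine ENNReal.ofReal_le_ofReal ?_
  simp only [Fin.sum_univ_one]
  rw [← tupleNorm_const (B := B)]
  rfl

/-- If `q` is a projection and `σ₂(q)` kills the vector `y` of the unit ball, then
`2 ‖σ₁(q) y‖ ≤ ‖σ₁ - σ₂‖_cb`. -/
theorem two_mul_norm_le_cbNorm (σ₁ σ₂ : LeftAction A B E) {q : A} (hq : IsStarProjection q) {y : E}
    (hy : ‖y‖ ≤ 1) (h₂ : σ₂.toAlgHom q y = 0) :
    ENNReal.ofReal (2 * ‖σ₁.toAlgHom q y‖) ≤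
      cbNorm B fun a => σ₁.toAlgHom a - σ₂.toAlgHom a := by
  have h1 : q * q = q := hq.isIdempotentElem
  have h2 : star q = q := hq.isSelfAdjoint
  -- Through `σ₂` the symmetry `2q - 1` acts on `y` as `-1`, so the difference of the two actions
  -- sends `y` to `2 σ₁(q) y`.
  have ht : star (2 • q - 1) * (2 • q - 1) = 1 := by
    simp only [star_sub, star_nsmul, h2, star_one, sub_mul, mul_sub, smul_mul_smul_comm, h1,
      one_mul,
      mul_one]
    module
  refine le_trans (le_of_eq ?_)
    (norm_le_cbNorm_of_unitary (fun a => σ₁.toAlgHom a - σ₂.toAlgHom a) ht hy)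
  have : (σ₁.toAlgHom (2 • q - 1) - σ₂.toAlgHom (2 • q - 1)) y = (2 : ℂ) • σ₁.toAlgHom q y := by
    simp only [map_sub, map_nsmul, map_one, sub_apply, smul_apply, h₂]
    module
  rw [this, norm_smul]
  simp

end HilbertModuleLemmas

/-! ### Algebras of operators -/

/-- A faithful representation of `B` on `H` whose range contains the compact operators. -/
structure OperatorRep (B H : Type u) [CStarAlgebra B] [PartialOrder B] [NormedAddCommGroup H]
    [InnerProductSpace ℂ H] [CompleteSpace H] where
  π : B →⋆ₐ[ℂ] (H →L[ℂ] H)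
  injective : Function.Injective π
  nonneg_iff : ∀ b, 0 ≤ π b ↔ 0 ≤ b
  exists_eq : ∀ K : H →L[ℂ] H, IsCompactOperator K → ∃ b, π b = K

section OperatorReps

variable {H : Type u} [NormedAddCommGroup H] [InnerProductSpace ℂ H] [CompleteSpace H]

/-- The inclusion of `𝒦₊` in `B(H)`. -/
noncomputable def kPlusRep (H : Type u) [NormedAddCommGroup H] [InnerProductSpace ℂ H]
    [CompleteSpace H] : OperatorRep (kPlus H) H where
  π := (kPlus H).subtype
  injective := Subtype.val_injective
  nonneg_iff _ := Iff.rfl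
  exists_eq K hK := ⟨⟨K, mem_kPlus_of_compact hK⟩, rfl⟩

/-- The identity representation of `B(H)`. -/
noncomputable def fullRep (H : Type u) [NormedAddCommGroup H] [InnerProductSpace ℂ H]
    [CompleteSpace H] : OperatorRep (H →L[ℂ] H) H where
  π := StarAlgHom.id ℂ _
  injective := Function.injective_id
  nonneg_iff _ := Iff.rfl
  exists_eq K _ := ⟨K, rfl⟩

variable {B : Type u} [CStarAlgebra B] [PartialOrder B] (ρ : OperatorRep B H)

theorem OperatorRep.norm_map (b : B) : ‖ρ.π b‖ = ‖b‖ :=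
  NonUnitalStarAlgHom.norm_map ρ.π ρ.injective b

theorem norm_le_of_re_inner_le {P : H →L[ℂ] H} (hP : 0 ≤ P) {r : ℝ} (hr : 0 ≤ r)
    (h : ∀ v, RCLike.re (inner ℂ v (P v)) ≤ r * ‖v‖ ^ 2) : ‖P‖ ≤ r := by
  rw [CStarAlgebra.norm_le_iff_le_algebraMap P hr hP, ContinuousLinearMap.le_def,
    ContinuousLinearMap.isPositive_def']
  have hsa : IsSelfAdjoint P := IsSelfAdjoint.of_nonneg hP
  refine ⟨(IsSelfAdjoint.algebraMap _ (IsSelfAdjoint.all r)).sub hsa, fun v => ?_⟩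
  rw [ContinuousLinearMap.reApplyInnerSelf_apply, inner_re_symm]
  simp only [sub_apply, Algebra.algebraMap_eq_smul_one, smul_apply,
    one_apply_eq_self, _root_.inner_sub_right, map_sub]
  have := h v
  rw [RCLike.real_smul_eq_coe_smul (K := ℂ), _root_.inner_smul_right, inner_self_eq_norm_sq_to_K]
  norm_cast
  simp only [RCLike.re_to_complex] at *
  norm_cast
  linarith

theorem re_inner_apply_le (P : H →L[ℂ] H) (v : H) :
    RCLike.re (inner ℂ v (P v)) ≤ ‖P‖ * ‖v‖ ^ 2 := by
  refine (re_inner_le_norm v (P v)).trans ?_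
  nlinarith [P.le_opNorm v, norm_nonneg v]

section Concrete

variable {G : Type u} [NormedAddCommGroup G] [InnerProductSpace ℂ G] [CompleteSpace G]

/-- A closed space of operators from `H` to `G` that is a Hilbert `B`-module for the inner product
`⟨S, T⟩ = S⋆ T`. -/
structure ColumnModule (ρ : OperatorRep B H) (G : Type u) [NormedAddCommGroup G]
    [InnerProductSpace ℂ G] [CompleteSpace G] where
  M : Submodule ℂ (H →L[ℂ] G)
  isClosed : IsClosed (M : Set (H →L[ℂ] G))
  comp_mem : ∀ T ∈ M, ∀ b, T ∘L ρ.π b ∈ M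
  inner_mem : ∀ S ∈ M, ∀ T ∈ M, ∃ b, ρ.π b = ContinuousLinearMap.adjoint S ∘L T

variable {ρ}

/-- The elements of a column module. -/
def ColumnModule.Carrier (X : ColumnModule ρ G) : Type u := X.M

noncomputable instance (X : ColumnModule ρ G) : NormedAddCommGroup X.Carrier :=
  inferInstanceAs (NormedAddCommGroup X.M)

noncomputable instance (X : ColumnModule ρ G) : NormedSpace ℂ X.Carrier :=
  inferInstanceAs (NormedSpace ℂ X.M)

theorem ColumnModule.coe_add (X : ColumnModule ρ G) (S T : X.Carrier) : (S + T).1 = S.1 + T.1 := rfl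

theorem ColumnModule.coe_sub (X : ColumnModule ρ G) (S T : X.Carrier) : (S - T).1 = S.1 - T.1 := rfl

theorem ColumnModule.coe_smul (X : ColumnModule ρ G) (c : ℂ) (T : X.Carrier) :
    (c • T).1 = c • T.1 := rfl

theorem ColumnModule.coe_sum (X : ColumnModule ρ G) {ι : Type*} (s : Finset ι) (f : ι → X.Carrier) :
    (∑ i ∈ s, f i).1 = ∑ i ∈ s, (f i).1 :=
  Submodule.coe_sum X.M f s

noncomputable instance (X : ColumnModule ρ G) : Module Bᵐᵒᵖ X.Carrier where
  smul b T := ⟨T.1 ∘L ρ.π b.unop, X.comp_mem _ T.2 _⟩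
  one_smul T := Subtype.ext <| show T.1 ∘L ρ.π 1 = T.1 by rw [map_one]; rfl
  mul_smul b c T := Subtype.ext <| show T.1 ∘L ρ.π (c.unop * b.unop) = _ by rw [map_mul]; rfl
  smul_zero b := Subtype.ext <| ContinuousLinearMap.zero_comp _
  smul_add b S T := Subtype.ext <| ContinuousLinearMap.add_comp _ _ _
  add_smul b c T := Subtype.ext <|
    show T.1 ∘L ρ.π (b.unop + c.unop) = _ by rw [map_add, ContinuousLinearMap.comp_add]; rfl
  zero_smul T := Subtype.ext <|
    show T.1 ∘L ρ.π 0 = 0 by rw [map_zero, ContinuousLinearMap.comp_zero]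

theorem ColumnModule.coe_op_smul (X : ColumnModule ρ G) (b : B) (T : X.Carrier) :
    (MulOpposite.op b • T : X.Carrier).1 = T.1 ∘L ρ.π b := rfl

noncomputable instance (X : ColumnModule ρ G) : Inner B X.Carrier where
  inner S T := Classical.choose (X.inner_mem _ S.2 _ T.2)

theorem ColumnModule.map_inner (X : ColumnModule ρ G) (S T : X.Carrier) :
    ρ.π (inner B S T) = ContinuousLinearMap.adjoint S.1 ∘L T.1 :=
  Classical.choose_spec (X.inner_mem _ S.2 _ T.2)

theorem norm_adjoint_comp_self' (T : H →L[ℂ] G) :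
    ‖ContinuousLinearMap.adjoint T ∘L T‖ = ‖T‖ ^ 2 := by
  rw [ContinuousLinearMap.norm_adjoint_comp_self, sq]

noncomputable instance (X : ColumnModule ρ G) : HilbertModule B X.Carrier where
  inner_add_right x y z := ρ.injective <| by
    rw [map_add, X.map_inner, X.map_inner, X.map_inner, X.coe_add,
      ContinuousLinearMap.comp_add]
  inner_smul_right c x y := ρ.injective <| by
    rw [map_smul, X.map_inner, X.map_inner, X.coe_smul, ContinuousLinearMap.comp_smul]
  inner_op_smul_right b x y := ρ.injective <| by
    rw [map_mul, X.map_inner, X.map_inner, X.coe_op_smul]; rfl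
  star_inner x y := ρ.injective <| by
    rw [map_star, X.map_inner, X.map_inner, ContinuousLinearMap.star_eq_adjoint,
      ContinuousLinearMap.adjoint_comp, ContinuousLinearMap.adjoint_adjoint]
  inner_self_nonneg x := (ρ.nonneg_iff _).1 <| by
    rw [X.map_inner, ContinuousLinearMap.nonneg_iff_isPositive]
    exact ContinuousLinearMap.isPositive_adjoint_comp_self _
  norm_sq_eq x := by
    rw [← ρ.norm_map, X.map_inner, norm_adjoint_comp_self']; rfl
  complete := X.isClosed.completeSpace_coe

variable {A : Type u} [CStarAlgebra A]

/-- Composition on the left with an operator on `G` that preserves the column module. -/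
noncomputable def ColumnModule.compLeft (X : ColumnModule ρ G) (S : G →L[ℂ] G)
    (h : ∀ T ∈ X.M, S ∘L T ∈ X.M) : X.Carrier →L[ℂ] X.Carrier :=
  LinearMap.mkContinuous
    { toFun := fun T => (⟨S ∘L T.1, h _ T.2⟩ : X.Carrier)
      map_add' := fun _ _ => Subtype.ext <| ContinuousLinearMap.comp_add _ _ _
      map_smul' := fun _ _ => Subtype.ext <| ContinuousLinearMap.comp_smul _ _ _ }
    ‖S‖ fun T => ContinuousLinearMap.opNorm_comp_le S T.1

theorem ColumnModule.coe_compLeft (X : ColumnModule ρ G) (S : G →L[ℂ] G)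
    (h : ∀ T ∈ X.M, S ∘L T ∈ X.M) (T : X.Carrier) : (X.compLeft S h T).1 = S ∘L T.1 := rfl

theorem ColumnModule.inner_compLeft (X : ColumnModule ρ G) (S S' : G →L[ℂ] G)
    (h : ∀ T ∈ X.M, S ∘L T ∈ X.M) (h' : ∀ T ∈ X.M, S' ∘L T ∈ X.M) (hS : S' = star S)
    (x y : X.Carrier) :
    inner B (X.compLeft S h x) y = inner B x (X.compLeft S' h' y) := ρ.injective <| by
  subst hS
  rw [X.map_inner, X.map_inner, X.coe_compLeft, X.coe_compLeft, ContinuousLinearMap.adjoint_comp,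
    ContinuousLinearMap.star_eq_adjoint, ContinuousLinearMap.comp_assoc]

/-- The homomorphism into the operators on a column module induced by a representation on `G`. -/
noncomputable def ColumnModule.actionHom (X : ColumnModule ρ G) (τ : A →⋆ₐ[ℂ] (G →L[ℂ] G))
    (h : ∀ a, ∀ T ∈ X.M, τ a ∘L T ∈ X.M) : A →ₐ[ℂ] (X.Carrier →L[ℂ] X.Carrier) :=
  AlgHom.ofLinearMap
    { toFun := fun a => X.compLeft (τ a) (h a)
      map_add' := fun a b => by
        refine ContinuousLinearMap.ext fun T => Subtype.ext ?_
        rw [add_apply, X.coe_add, X.coe_compLeft, X.coe_compLeft, X.coe_compLeft, map_add,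
          ContinuousLinearMap.add_comp]
      map_smul' := fun c a => by
        refine ContinuousLinearMap.ext fun T => Subtype.ext ?_
        rw [RingHom.id_apply, smul_apply, X.coe_smul, X.coe_compLeft, X.coe_compLeft,
          map_smul, ContinuousLinearMap.smul_comp] }
    (by
      refine ContinuousLinearMap.ext fun T => Subtype.ext ?_
      rw [LinearMap.coe_mk, AddHom.coe_mk, X.coe_compLeft, map_one]; rfl)
    fun a b => by
      refine ContinuousLinearMap.ext fun T => Subtype.ext ?_
      rw [mul_apply_eq_comp, LinearMap.coe_mk, AddHom.coe_mk, X.coe_compLeft, X.coe_compLeft,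
        X.coe_compLeft, map_mul]
      rfl

/-- The left action of `A` on a column module through a representation of `A` on `G`. -/
noncomputable def ColumnModule.action (X : ColumnModule ρ G) (τ : A →⋆ₐ[ℂ] (G →L[ℂ] G))
    (h : ∀ a, ∀ T ∈ X.M, τ a ∘L T ∈ X.M) : LeftAction A B X.Carrier where
  toAlgHom := X.actionHom τ h
  inner_map_left a x y := X.inner_compLeft _ _ (h a) (h (star a)) (map_star τ a) x y

theorem ColumnModule.coe_action (X : ColumnModule ρ G) (τ : A →⋆ₐ[ℂ] (G →L[ℂ] G))
    (h : ∀ a, ∀ T ∈ X.M, τ a ∘L T ∈ X.M) (a : A) (T : X.Carrier) :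
    ((X.action τ h).toAlgHom a T).1 = τ a ∘L T.1 := rfl

/-- Evaluating at vectors `v` of `H` turns `tupleNorm` into sums of squared norms in `G`, so cb norm
estimates reduce to Hilbert space estimates. -/
theorem ColumnModule.re_inner_sum (X : ColumnModule ρ G) {n : ℕ} (x : Fin n → X.Carrier) (v : H) :
    RCLike.re (inner ℂ v (ρ.π (∑ i, inner B (x i) (x i)) v)) = ∑ i, ‖(x i).1 v‖ ^ 2 := by
  rw [map_sum]
  simp only [X.map_inner, sum_apply, ContinuousLinearMap.comp_apply, _root_.inner_sum, map_sum,
    ContinuousLinearMap.adjoint_inner_right, inner_self_eq_norm_sq]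

theorem ColumnModule.sum_norm_sq_le (X : ColumnModule ρ G) {n : ℕ} (x : Fin n → X.Carrier)
    (hx : tupleNorm B x ≤ 1) (v : H) : ∑ i, ‖(x i).1 v‖ ^ 2 ≤ ‖v‖ ^ 2 := by
  rw [← X.re_inner_sum]
  refine (re_inner_apply_le _ v).trans ?_
  have : ‖∑ i, inner B (x i) (x i)‖ ≤ 1 := by
    have := Real.sqrt_le_one (x := ‖∑ i, inner B (x i) (x i)‖)
    rw [tupleNorm] at hx
    nlinarith [Real.sq_sqrt (norm_nonneg (∑ i, inner B (x i) (x i))),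
      Real.sqrt_nonneg ‖∑ i, inner B (x i) (x i)‖]
  rw [ρ.norm_map]
  nlinarith [sq_nonneg ‖v‖]

theorem ColumnModule.tupleNorm_le (X : ColumnModule ρ G) {n : ℕ} (x : Fin n → X.Carrier) {r : ℝ}
    (hr : 0 ≤ r) (h : ∀ v, ∑ i, ‖(x i).1 v‖ ^ 2 ≤ r ^ 2 * ‖v‖ ^ 2) : tupleNorm B x ≤ r := by
  rw [tupleNorm, Real.sqrt_le_left hr, ← ρ.norm_map]
  refine norm_le_of_re_inner_le ?_ (sq_nonneg r) fun v => by rw [X.re_inner_sum]; exact h v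
  rw [map_sum]
  exact Finset.sum_nonneg fun i _ => (ρ.nonneg_iff _).2 (HilbertModule.inner_self_nonneg _)

end Concrete

end OperatorReps

/-! ### Ampliations of representations -/

section Ampliation

variable {A G : Type u} [CStarAlgebra A] [PartialOrder A] [StarOrderedRing A]
  [NormedAddCommGroup G] [InnerProductSpace ℂ G] [CompleteSpace G]

theorem re_inner_ampliation (τ : A →⋆ₐ[ℂ] (G →L[ℂ] G)) {n : ℕ}
    (a : CStarMatrix (Fin n) (Fin n) A) (g : Fin n → G) :
    ∑ i, ‖∑ j, τ (a i j) (g j)‖ ^ 2 =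
      RCLike.re (∑ i, ∑ j, inner ℂ (g i) (τ ((star a * a) i j) (g j))) := by
  have h : ∀ i, ((‖∑ j, τ (a i j) (g j)‖ ^ 2 : ℝ) : ℂ) =
      ∑ j, ∑ k, inner ℂ (g j) (τ (star (a i j) * a i k) (g k)) := by
    intro i
    push_cast
    rw [← RCLike.ofReal_eq_complex_ofReal, ← inner_self_eq_norm_sq_to_K, sum_inner]
    refine Finset.sum_congr rfl fun j _ => ?_
    rw [_root_.inner_sum]
    refine Finset.sum_congr rfl fun k _ => ?_
    rw [map_mul, map_star, ContinuousLinearMap.star_eq_adjoint]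
    exact (ContinuousLinearMap.adjoint_inner_right _ _ _).symm
  have h2 : ((∑ i, ‖∑ j, τ (a i j) (g j)‖ ^ 2 : ℝ) : ℂ) =
      ∑ i, ∑ j, inner ℂ (g i) (τ ((star a * a) i j) (g j)) := by
    push_cast
    push_cast at h
    rw [Finset.sum_congr rfl fun i _ => h i, Finset.sum_comm]
    refine Finset.sum_congr rfl fun j _ => ?_
    rw [Finset.sum_comm]
    refine Finset.sum_congr rfl fun k _ => ?_
    rw [CStarMatrix.mul_apply, map_sum, sum_apply, _root_.inner_sum]
    simp [CStarMatrix.star_apply]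
  rw [← h2]
  exact (Complex.ofReal_re _).symm

theorem exists_one_sub_star_mul_self {R : Type*} [CStarAlgebra R] [PartialOrder R]
    [StarOrderedRing R] {a : R} (ha : ‖a‖ ≤ 1) : ∃ b, 1 - star a * a = star b * b := by
  have h1 : star a * a ≤ 1 := by
    rw [← CStarAlgebra.norm_le_one_iff_of_nonneg _ (star_mul_self_nonneg a),
      CStarRing.norm_star_mul_self]
    nlinarith [norm_nonneg a]
  exact CStarAlgebra.nonneg_iff_eq_star_mul_self.1 (sub_nonneg.2 h1)

/-- In the matrix algebra `1 - a⋆ a = b⋆ b`, and `re_inner_ampliation` identifies the difference of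
the two sides with the sum of squares belonging to `b`. -/
theorem sum_norm_sq_ampliation_le (τ : A →⋆ₐ[ℂ] (G →L[ℂ] G)) {n : ℕ}
    (a : CStarMatrix (Fin n) (Fin n) A) (ha : ‖a‖ ≤ 1) (g : Fin n → G) :
    ∑ i, ‖∑ j, τ (a i j) (g j)‖ ^ 2 ≤ ∑ i, ‖g i‖ ^ 2 := by
  obtain ⟨b, hb⟩ := exists_one_sub_star_mul_self ha
  have h2 := re_inner_ampliation τ b g
  have h3 : ∑ i, ‖g i‖ ^ 2 =
      RCLike.re (∑ i, ∑ j, inner ℂ (g i)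
        (τ ((1 : CStarMatrix (Fin n) (Fin n) A) i j) (g j))) := by
    rw [map_sum]
    refine Finset.sum_congr rfl fun i _ => ?_
    rw [Finset.sum_eq_single i, CStarMatrix.one_apply_eq, map_one]
    · exact (inner_self_eq_norm_sq (𝕜 := ℂ) (g i)).symm
    · intro j _ hj
      rw [CStarMatrix.one_apply_ne hj.symm, map_zero]; simp
    · simp
  rw [h3, re_inner_ampliation, ← sub_nonneg, ← map_sub, ← Finset.sum_sub_distrib]
  simp only [← Finset.sum_sub_distrib, ← _root_.inner_sub_right, ← sub_apply, ← map_sub,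
    ← CStarMatrix.sub_apply]
  rw [hb, ← h2]
  positivity

/-- With `g = C k` the difference becomes a commutator, in which `C` may be replaced by `C - l`:
`τ(a) (C - l) k - (C - l) τ(a) k`. Each term is controlled by `r` and the contractivity of the
ampliation. -/
theorem sum_norm_sq_commutator_le (τ : A →⋆ₐ[ℂ] (G →L[ℂ] G)) {n : ℕ}
    (a : CStarMatrix (Fin n) (Fin n) A) (ha : ‖a‖ ≤ 1) (C : G →L[ℂ] G) (hC : C * star C = 1)
    (l : ℂ) {r : ℝ} (hr : ∀ k, ‖C k - l • k‖ ≤ r * ‖k‖) (g : Fin n → G) :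
    ∑ i, ‖∑ j, (τ (a i j) - C * τ (a i j) * star C) (g j)‖ ^ 2 ≤
      (2 * r) ^ 2 * ∑ i, ‖star C (g i)‖ ^ 2 := by
  set k : Fin n → G := fun j => star C (g j)
  have hg : ∀ j, g j = C (k j) := fun j => by
    rw [← mul_apply_eq_comp, hC]; rfl
  have hr2 : ∀ v, ‖C v - l • v‖ ^ 2 ≤ r ^ 2 * ‖v‖ ^ 2 := fun v => by
    rw [← mul_pow]
    exact pow_le_pow_left₀ (norm_nonneg _) (hr v) 2
  have h1 : ∀ i, ∑ j, (τ (a i j) - C * τ (a i j) * star C) (g j) =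
      (∑ j, τ (a i j) (C (k j) - l • k j)) -
        (C (∑ j, τ (a i j) (k j)) - l • ∑ j, τ (a i j) (k j)) := by
    intro i
    rw [map_sum, Finset.smul_sum, ← Finset.sum_sub_distrib, ← Finset.sum_sub_distrib]
    refine Finset.sum_congr rfl fun j _ => ?_
    rw [map_sub, map_smul, sub_sub_sub_cancel_right, ← hg j]
    rfl
  -- Both terms have the same bound `r`, so this inequality still yields the constant `(2 r)²`.
  have h2 : ∀ x y : G, ‖x - y‖ ^ 2 ≤ 2 * ‖x‖ ^ 2 + 2 * ‖y‖ ^ 2 := fun x y => by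
    have := norm_sub_le x y
    nlinarith [norm_nonneg (x - y), sq_nonneg (‖x‖ - ‖y‖)]
  calc _ ≤ ∑ i, (2 * ‖∑ j, τ (a i j) (C (k j) - l • k j)‖ ^ 2 +
        2 * (r ^ 2 * ‖∑ j, τ (a i j) (k j)‖ ^ 2)) := by
        refine Finset.sum_le_sum fun i _ => ?_
        rw [h1]
        refine (h2 _ _).trans ?_
        gcongr
        exact hr2 _
    _ = 2 * ∑ i, ‖∑ j, τ (a i j) (C (k j) - l • k j)‖ ^ 2 +
        2 * r ^ 2 * ∑ i, ‖∑ j, τ (a i j) (k j)‖ ^ 2 := by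
        rw [Finset.sum_add_distrib, Finset.mul_sum, Finset.mul_sum]
        simp only [mul_assoc]
    _ ≤ 2 * ∑ i, ‖C (k i) - l • k i‖ ^ 2 + 2 * r ^ 2 * ∑ i, ‖k i‖ ^ 2 := by
        have h3 := sum_norm_sq_ampliation_le τ a ha fun j => C (k j) - l • k j
        have h4 := mul_le_mul_of_nonneg_left (sum_norm_sq_ampliation_le τ a ha k)
          (by positivity : 0 ≤ 2 * r ^ 2)
        linarith
    _ ≤ 2 * ∑ i, r ^ 2 * ‖k i‖ ^ 2 + 2 * r ^ 2 * ∑ i, ‖k i‖ ^ 2 := by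
        gcongr with i
        exact hr2 _
    _ = _ := by rw [← Finset.mul_sum]; ring

end Ampliation

open InnerProductSpace

/-! ### Vectors represented by operators -/


section Represented

open HilbertModule

variable {A B E H G : Type u} [CStarAlgebra A] [PartialOrder A] [StarOrderedRing A]
  [CStarAlgebra B] [PartialOrder B] [NormedAddCommGroup E]
  [NormedSpace ℂ E] [Module Bᵐᵒᵖ E] [HilbertModule B E]
  [NormedAddCommGroup H] [InnerProductSpace ℂ H] [CompleteSpace H]
  [NormedAddCommGroup G] [InnerProductSpace ℂ G] [CompleteSpace G]

theorem OperatorRep.norm_sq (ρ : OperatorRep B H) (y : E) : ‖y‖ ^ 2 = ‖ρ.π (inner B y y)‖ := by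
  rw [ρ.norm_map, norm_sq_eq (B := B)]

theorem OperatorRep.re_inner_le (ρ : OperatorRep B H) (y : E) (v : H) :
    RCLike.re (inner ℂ v (ρ.π (inner B y y) v)) ≤ ‖y‖ ^ 2 * ‖v‖ ^ 2 := by
  rw [ρ.norm_sq]
  exact re_inner_apply_le _ v

theorem OperatorRep.re_inner_nonneg (ρ : OperatorRep B H) (y : E) (v : H) :
    0 ≤ RCLike.re (inner ℂ v (ρ.π (inner B y y) v)) := by
  have h := (ρ.nonneg_iff _).2 (HilbertModule.inner_self_nonneg (B := B) y)
  rw [ContinuousLinearMap.nonneg_iff_isPositive] at h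
  exact h.re_inner_nonneg_right v

theorem OperatorRep.adjoint_map_inner (ρ : OperatorRep B H) (x y : E) :
    ContinuousLinearMap.adjoint (ρ.π (inner B x y)) = ρ.π (inner B y x) := by
  rw [← ContinuousLinearMap.star_eq_adjoint, ← map_star, star_inner]

/-- The state `a ↦ ⟨x, σ(a) x⟩` is the compression `z⋆ τ(a) z`. -/
def Represents (ρ : OperatorRep B H) (τ : A →⋆ₐ[ℂ] (G →L[ℂ] G)) (σ : LeftAction A B E) (x : E)
    (z : H →L[ℂ] G) : Prop :=
  ∀ a, ρ.π (inner B x (σ.toAlgHom a x)) = ContinuousLinearMap.adjoint z ∘L τ a ∘L z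

variable {ρ : OperatorRep B H} {τ : A →⋆ₐ[ℂ] (G →L[ℂ] G)} {σ : LeftAction A B E} {x : E}
  {z : H →L[ℂ] G}

namespace Represents

/-- This is the dictionary: `σ(a) x b ↦ τ(a) z π(b)` preserves inner products of generators. -/
theorem map_inner (hx : Represents ρ τ σ x z) (a a' : A) (b b' : B) :
    ρ.π (inner B (MulOpposite.op b • σ.toAlgHom a x) (MulOpposite.op b' • σ.toAlgHom a' x)) =
      ContinuousLinearMap.adjoint (τ a ∘L z ∘L ρ.π b) ∘L (τ a' ∘L z ∘L ρ.π b') := by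
  rw [inner_op_smul_left, inner_op_smul_right, σ.inner_map_left, ← mul_apply_eq_comp, ← map_mul,
    map_mul, map_mul, hx, map_mul, map_star, map_star]
  simp only [ContinuousLinearMap.star_eq_adjoint, ContinuousLinearMap.adjoint_comp]
  rfl

theorem map_inner_apply (hx : Represents ρ τ σ x z) (a a' : A) :
    ρ.π (inner B (σ.toAlgHom a x) (σ.toAlgHom a' x)) =
      ContinuousLinearMap.adjoint (τ a ∘L z) ∘L (τ a' ∘L z) := by
  have h := hx.map_inner a a' 1 1
  rw [MulOpposite.op_one, one_smul, one_smul, map_one] at h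
  exact h

theorem norm_op_smul (hx : Represents ρ τ σ x z) (a : A) (b : B) :
    ‖MulOpposite.op b • σ.toAlgHom a x‖ = ‖τ a ∘L z ∘L ρ.π b‖ := by
  rw [← sq_eq_sq₀ (norm_nonneg _) (norm_nonneg _), ρ.norm_sq, hx.map_inner, norm_adjoint_comp_self']

/-- The correspondence is isometric, hence equalities of generators in `E` can be checked on
operators. -/
theorem op_smul_congr (hx : Represents ρ τ σ x z) {a a' : A} {b b' : B}
    (h : τ a ∘L z ∘L ρ.π b = τ a' ∘L z ∘L ρ.π b') :
    MulOpposite.op b • σ.toAlgHom a x = MulOpposite.op b' • σ.toAlgHom a' x := by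
  refine sub_eq_zero.1 (eq_zero_of_inner_self (B := B) (ρ.injective ?_))
  simp only [HilbertModule.inner_sub_left, HilbertModule.inner_sub_right, map_sub, hx.map_inner, h,
    sub_self, map_zero]

end Represents

theorem ColumnModule.represents (X : ColumnModule ρ G) (τ : A →⋆ₐ[ℂ] (G →L[ℂ] G))
    (h : ∀ a, ∀ T ∈ X.M, τ a ∘L T ∈ X.M) (T : X.Carrier) : Represents ρ τ (X.action τ h) T T.1 :=
  fun _ => X.map_inner _ _

end Represented

/-! ### Upper bounds for the two distances -/

section UpperBounds

variable {A B H G : Type u} [CStarAlgebra A] [PartialOrder A] [StarOrderedRing A]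
  [CStarAlgebra B] [PartialOrder B] [StarOrderedRing B]
  [NormedAddCommGroup H] [InnerProductSpace ℂ H] [CompleteSpace H]
  [NormedAddCommGroup G] [InnerProductSpace ℂ G] [CompleteSpace G]
  {ρ : OperatorRep B H} {φ₁ φ₂ : A →ₗ[ℂ] B}

theorem ColumnModule.buresDist_le (X : ColumnModule ρ G) (τ : A →⋆ₐ[ℂ] (G →L[ℂ] G))
    (h : ∀ a, ∀ T ∈ X.M, τ a ∘L T ∈ X.M) (x₁ x₂ : X.Carrier)
    (h₁ : ∀ a, ρ.π (φ₁ a) = ContinuousLinearMap.adjoint x₁.1 ∘L τ a ∘L x₁.1)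
    (h₂ : ∀ a, ρ.π (φ₂ a) = ContinuousLinearMap.adjoint x₂.1 ∘L τ a ∘L x₂.1) :
    buresDist φ₁ φ₂ ≤ ENNReal.ofReal ‖x₁.1 - x₂.1‖ :=
  iInf_le_of_le
    { E := X.Carrier
      σ := X.action τ h
      x₁ := x₁
      x₂ := x₂
      map₁ := fun a => ρ.injective ((h₁ a).trans (X.represents τ h x₁ a).symm)
      map₂ := fun a => ρ.injective ((h₂ a).trans (X.represents τ h x₂ a).symm) } le_rfl

theorem ColumnModule.cbNorm_le (X : ColumnModule ρ G) (τ τ' : A →⋆ₐ[ℂ] (G →L[ℂ] G))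
    (h : ∀ a, ∀ T ∈ X.M, τ a ∘L T ∈ X.M) (h' : ∀ a, ∀ T ∈ X.M, τ' a ∘L T ∈ X.M)
    {C : G →L[ℂ] G} (hC : C ∈ unitary (G →L[ℂ] G)) (hτ : ∀ a, τ' a = C * τ a * star C)
    (l : ℂ) {r : ℝ} (hr₀ : 0 ≤ r) (hr : ∀ k, ‖C k - l • k‖ ≤ r * ‖k‖) :
    cbNorm B (fun a => (X.action τ h).toAlgHom a - (X.action τ' h').toAlgHom a) ≤
      ENNReal.ofReal (2 * r) := by
  refine iSup_le fun n => iSup_le fun a => iSup_le fun ha => iSup_le fun x => iSup_le fun hx => ?_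
  refine ENNReal.ofReal_le_ofReal (X.tupleNorm_le _ (by positivity) fun v => ?_)
  have h1 := sum_norm_sq_commutator_le τ a ha C (Unitary.mul_star_self_of_mem hC) l hr
    fun j => (x j).1 v
  have h2 : ∀ g, ‖star C g‖ = ‖g‖ := fun g => by
    rw [← sq_eq_sq₀ (norm_nonneg _) (norm_nonneg _), ← inner_self_eq_norm_sq (𝕜 := ℂ),
      ← inner_self_eq_norm_sq (𝕜 := ℂ), ContinuousLinearMap.star_eq_adjoint,
      ContinuousLinearMap.adjoint_inner_left, ← ContinuousLinearMap.star_eq_adjoint,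
      ← mul_apply_eq_comp, Unitary.mul_star_self_of_mem hC]
    rfl
  simp only [h2] at h1
  have h3 : ∀ i, (∑ j, ((X.action τ h).toAlgHom (a i j) - (X.action τ' h').toAlgHom (a i j))
      (x j)).1 v = ∑ j, (τ (a i j) - C * τ (a i j) * star C) ((x j).1 v) := fun i => by
    rw [X.coe_sum, sum_apply]
    refine Finset.sum_congr rfl fun j _ => ?_
    rw [sub_apply, X.coe_sub, X.coe_action, X.coe_action, hτ]
    rfl
  simp only [h3]
  exact h1.trans (mul_le_mul_of_nonneg_left (X.sum_norm_sq_le x hx v) (sq_nonneg _))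

theorem ColumnModule.repMetric_le (X : ColumnModule ρ G) (τ τ' : A →⋆ₐ[ℂ] (G →L[ℂ] G))
    (h : ∀ a, ∀ T ∈ X.M, τ a ∘L T ∈ X.M) (h' : ∀ a, ∀ T ∈ X.M, τ' a ∘L T ∈ X.M)
    {C : G →L[ℂ] G} (hC : C ∈ unitary (G →L[ℂ] G)) (hτ : ∀ a, τ' a = C * τ a * star C)
    (l : ℂ) {r : ℝ} (hr₀ : 0 ≤ r) (hr : ∀ k, ‖C k - l • k‖ ≤ r * ‖k‖) (x : X.Carrier)
    (hx : ContinuousLinearMap.adjoint x.1 ∘L x.1 = 1)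
    (h₁ : ∀ a, ρ.π (φ₁ a) = ContinuousLinearMap.adjoint x.1 ∘L τ a ∘L x.1)
    (h₂ : ∀ a, ρ.π (φ₂ a) = ContinuousLinearMap.adjoint x.1 ∘L τ' a ∘L x.1) :
    repMetric φ₁ φ₂ ≤ ENNReal.ofReal (2 * r) :=
  iInf_le_of_le
    { E := X.Carrier
      σ₁ := X.action τ h
      σ₂ := X.action τ' h'
      x := x
      inner_self := ρ.injective (by rw [X.map_inner, hx, map_one])
      map₁ := fun a => ρ.injective ((h₁ a).trans (X.represents τ h x a).symm)
      map₂ := fun a => ρ.injective ((h₂ a).trans (X.represents τ' h' x a).symm) }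
    (X.cbNorm_le τ τ' h h' hC hτ l hr₀ hr)

end UpperBounds

/-! ### Compact operators on infinite-dimensional subspaces -/

section Compact

variable {H : Type u} [NormedAddCommGroup H] [InnerProductSpace ℂ H] [CompleteSpace H]

theorem isCompactOperator_rankOne {G : Type u} [NormedAddCommGroup G] [InnerProductSpace ℂ G]
    (v : G) (w : H) : IsCompactOperator (rankOne ℂ v w) := by
  rw [rankOne_def']
  exact ((isCompactOperator_id (E := ℂ)).clm_comp
    (ContinuousLinearMap.toSpanSingleton ℂ v)).comp_clm (innerSL ℂ w)

/-- Otherwise `K` is bounded below on the closed range of `q`, thus a closed embedding there.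
Compactness of `K` then makes the identity of that range compact, which forces finite dimension. -/
theorem exists_norm_lt_of_compact {K : H →L[ℂ] H} (hK : IsCompactOperator K) {q : H →L[ℂ] H}
    (hq : IsIdempotentElem q)
    (hd : ¬ FiniteDimensional ℂ (LinearMap.range (q : H →ₗ[ℂ] H))) {ε : ℝ} (hε : 0 < ε) :
    ∃ v, q v = v ∧ ‖v‖ = 1 ∧ ‖K v‖ < ε := by
  by_contra! hcon
  apply hd
  set V := LinearMap.range (q : H →ₗ[ℂ] H)
  have hV : ∀ v ∈ V, q v = v := by
    rintro _ ⟨w, rfl⟩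
    exact DFunLike.congr_fun hq w
  have hVc : IsClosed (V : Set H) := by
    have : (V : Set H) = {v | q v = v} := by
      ext v
      exact ⟨hV v, fun h => ⟨v, h⟩⟩
    rw [this]
    exact isClosed_eq q.continuous continuous_id
  have : CompleteSpace V := hVc.completeSpace_coe
  set K' : V →L[ℂ] H := K ∘L V.subtypeL
  have hK' : IsCompactOperator K' := hK.comp_clm _
  have hbd : ∀ v : V, ε * ‖v‖ ≤ ‖K' v‖ := by
    intro v
    rcases eq_or_ne v 0 with rfl | hv
    · simp
    have hv' : 0 < ‖v‖ := norm_pos_iff.2 hv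
    have h1 := hcon (((‖v‖⁻¹ : ℝ) : ℂ) • (v : H)) (by rw [map_smul, hV v v.2]) (by
      rw [norm_smul, Complex.norm_real, norm_inv, norm_norm, Submodule.coe_norm]
      exact inv_mul_cancel₀ hv'.ne')
    rw [map_smul, norm_smul, Complex.norm_real, norm_inv, norm_norm] at h1
    calc ε * ‖v‖ ≤ ‖v‖⁻¹ * ‖K v‖ * ‖v‖ := by gcongr
      _ = ‖K v‖ := by field_simp
  have hanti : AntilipschitzWith (Real.toNNReal ε⁻¹) K' :=
    AddMonoidHomClass.antilipschitz_of_bound K' fun v => by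
      rw [Real.coe_toNNReal _ (inv_nonneg.2 hε.le)]
      rw [inv_mul_eq_div, le_div_iff₀ hε, mul_comm]
      exact hbd v
  have hemb := hanti.isClosedEmbedding K'.uniformContinuous
  obtain ⟨S, hS, hmem⟩ := hK'
  have hid : IsCompactOperator (id : V → V) := ⟨K' ⁻¹' S, hemb.isCompact_preimage hS, hmem⟩
  exact FiniteDimensional.of_isCompactOperator_id (𝕜 := ℂ) hid

end Compact

/-! ### Block operators on `H ⊕ H` -/

section Blocks

variable {H : Type u} [NormedAddCommGroup H] [InnerProductSpace ℂ H]

theorem HSum.ext {v w : HSum H} (h₀ : v.fst = w.fst) (h₁ : v.snd = w.snd) : v = w :=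
  (WithLp.equiv 2 (H × H)).injective (Prod.ext h₀ h₁)

@[simp] theorem column_fst (S T : H →L[ℂ] H) (h : H) : (column S T h).fst = S h := rfl

@[simp] theorem column_snd (S T : H →L[ℂ] H) (h : H) : (column S T h).snd = T h := rfl

@[simp] theorem coordIncl_zero_fst (h : H) : (coordIncl H 0 h).fst = h := by simp [coordIncl]

@[simp] theorem coordIncl_zero_snd (h : H) : (coordIncl H 0 h).snd = 0 := by simp [coordIncl]

@[simp] theorem coordIncl_one_fst (h : H) : (coordIncl H 1 h).fst = 0 := by simp [coordIncl]

@[simp] theorem coordIncl_one_snd (h : H) : (coordIncl H 1 h).snd = h := by simp [coordIncl]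

@[simp] theorem coordProj_zero_apply (v : HSum H) : coordProj H 0 v = v.fst := by simp [coordProj]

@[simp] theorem coordProj_one_apply (v : HSum H) : coordProj H 1 v = v.snd := by simp [coordProj]

@[simp] theorem zCol_fst (u : H →L[ℂ] H) (h : H) : (zCol u h).fst = ((√2 : ℝ) : ℂ)⁻¹ • u h := rfl

@[simp] theorem zCol_snd (u : H →L[ℂ] H) (h : H) : (zCol u h).snd = ((√2 : ℝ) : ℂ)⁻¹ • h := rfl

/-- The operator on `H ⊕ H` with matrix `![![a, b], ![c, d]]`. -/
noncomputable def blockOp (a b c d : H →L[ℂ] H) : HSum H →L[ℂ] HSum H :=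
  column a c ∘L coordProj H 0 + column b d ∘L coordProj H 1

@[simp] theorem blockOp_fst (a b c d : H →L[ℂ] H) (v : HSum H) :
    (blockOp a b c d v).fst = a v.fst + b v.snd := by
  simp [blockOp]

@[simp] theorem blockOp_snd (a b c d : H →L[ℂ] H) (v : HSum H) :
    (blockOp a b c d v).snd = c v.fst + d v.snd := by
  simp [blockOp]

theorem blockOp_one : blockOp (1 : H →L[ℂ] H) 0 0 1 = 1 := by
  ext v : 1
  apply HSum.ext <;> simp

theorem blockOp_mul (a b c d a' b' c' d' : H →L[ℂ] H) :
    blockOp a b c d * blockOp a' b' c' d' =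
      blockOp (a * a' + b * c') (a * b' + b * d') (c * a' + d * c') (c * b' + d * d') := by
  ext v : 1
  apply HSum.ext
  · simp; abel
  · simp; abel

theorem blockOp_add (a b c d a' b' c' d' : H →L[ℂ] H) :
    blockOp a b c d + blockOp a' b' c' d' = blockOp (a + a') (b + b') (c + c') (d + d') := by
  ext v : 1
  apply HSum.ext
  · simp; abel
  · simp; abel

theorem entry_blockOp (a b c d : H →L[ℂ] H) (i j : Fin 2) :
    entry i j (blockOp a b c d) = if i = 0 then (if j = 0 then a else b) else
      if j = 0 then c else d := by
  ext v
  fin_cases i <;> fin_cases j <;> simp [entry]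

theorem blockOp_entry (T : HSum H →L[ℂ] HSum H) :
    blockOp (entry 0 0 T) (entry 0 1 T) (entry 1 0 T) (entry 1 1 T) = T := by
  ext v : 1
  have hv : v = coordIncl H 0 v.fst + coordIncl H 1 v.snd := by apply HSum.ext <;> simp
  apply HSum.ext
  · conv_rhs => rw [hv]
    simp [entry]
  · conv_rhs => rw [hv]
    simp [entry]

theorem inner_inv_sqrt_two_smul {G : Type u} [NormedAddCommGroup G] [InnerProductSpace ℂ G]
    (x y : G) :
    inner ℂ (((√2 : ℝ) : ℂ)⁻¹ • x) (((√2 : ℝ) : ℂ)⁻¹ • y) = inner ℂ x y / 2 := by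
  have h2 : (starRingEnd ℂ) ((√2 : ℝ) : ℂ)⁻¹ * ((√2 : ℝ) : ℂ)⁻¹ = 1 / 2 := by
    rw [map_inv₀, Complex.conj_ofReal, ← mul_inv, ← Complex.ofReal_mul,
      Real.mul_self_sqrt zero_le_two]
    norm_num
  rw [inner_smul_left, inner_smul_right, ← mul_assoc, h2]
  ring

theorem inner_zCol (u u' : H →L[ℂ] H) (h h' : H) :
    inner ℂ (zCol u h) (zCol u' h') = (inner ℂ (u h) (u' h') + inner ℂ h h') / 2 := by
  rw [WithLp.prod_inner_apply]
  change inner ℂ (zCol u h).fst (zCol u' h').fst + inner ℂ (zCol u h).snd (zCol u' h').snd = _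
  rw [zCol_fst, zCol_fst, zCol_snd, zCol_snd, inner_inv_sqrt_two_smul, inner_inv_sqrt_two_smul]
  ring

variable [CompleteSpace H]

theorem star_blockOp (a b c d : H →L[ℂ] H) :
    star (blockOp a b c d) = blockOp (star a) (star c) (star b) (star d) := by
  rw [← blockOp_entry (star (blockOp a b c d))]
  simp only [entry_star, entry_blockOp]
  simp

theorem blockOp_mem_matAlg {a b c d : H →L[ℂ] H} (ha : a ∈ kPlus H) (hb : IsCompactOperator b)
    (hc : IsCompactOperator c) (hd : d ∈ kPlus H) : blockOp a b c d ∈ matAlg H := by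
  change entry 0 0 _ ∈ kPlus H ∧ IsCompactOperator (entry 0 1 _) ∧ IsCompactOperator (entry 1 0 _) ∧
    entry 1 1 _ ∈ kPlus H
  simp only [entry_blockOp]
  exact ⟨ha, hb, hc, hd⟩

theorem compact_mem_matAlg {T : HSum H →L[ℂ] HSum H} (hT : IsCompactOperator T) : T ∈ matAlg H := by
  have h : ∀ i j, IsCompactOperator (entry i j T) := fun i j =>
    (hT.comp_clm (coordIncl H j)).clm_comp (coordProj H i)
  exact ⟨mem_kPlus_of_compact (h 0 0), h 0 1, h 1 0, mem_kPlus_of_compact (h 1 1)⟩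

/-- The diagonal matrix units of `𝒜`. -/
noncomputable def diagUnit (H : Type u) [NormedAddCommGroup H] [InnerProductSpace ℂ H]
    [CompleteSpace H] (i : Fin 2) : matAlg H :=
  if i = 0 then ⟨blockOp 1 0 0 0, blockOp_mem_matAlg (one_mem _) isCompactOperator_zero
    isCompactOperator_zero (zero_mem _)⟩ else ⟨blockOp 0 0 0 1, blockOp_mem_matAlg (zero_mem _)
    isCompactOperator_zero isCompactOperator_zero (one_mem _)⟩

theorem coe_diagUnit_zero : (diagUnit H 0 : HSum H →L[ℂ] HSum H) = blockOp 1 0 0 0 := rfl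

theorem coe_diagUnit_one : (diagUnit H 1 : HSum H →L[ℂ] HSum H) = blockOp 0 0 0 1 := rfl

theorem diagUnit_add : diagUnit H 0 + diagUnit H 1 = 1 := by
  apply Subtype.ext
  change blockOp 1 0 0 0 + blockOp 0 0 0 1 = (1 : HSum H →L[ℂ] HSum H)
  rw [blockOp_add]
  simpa using blockOp_one

theorem star_diagUnit (i : Fin 2) : star (diagUnit H i) = diagUnit H i := by
  apply Subtype.ext
  fin_cases i
  · change star (blockOp 1 0 0 0) = blockOp 1 0 0 0
    rw [star_blockOp]; simp
  · change star (blockOp 0 0 0 1) = blockOp 0 0 0 1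
    rw [star_blockOp]; simp

theorem diagUnit_mul_self (i : Fin 2) : diagUnit H i * diagUnit H i = diagUnit H i := by
  apply Subtype.ext
  fin_cases i
  · change (blockOp 1 0 0 0) * (blockOp 1 0 0 0) = (blockOp 1 0 0 0 : HSum H →L[ℂ] HSum H)
    rw [blockOp_mul]; simp
  · change blockOp 0 0 0 1 * blockOp 0 0 0 1 = (blockOp 0 0 0 1 : HSum H →L[ℂ] HSum H)
    rw [blockOp_mul]; simp

/-- The projection `1 - |v⟩⟨v|` in `𝒜`. -/
noncomputable def rankOneCompl (v : HSum H) : matAlg H :=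
  ⟨1 - rankOne ℂ v v, sub_mem (one_mem _) (compact_mem_matAlg (isCompactOperator_rankOne v v))⟩

theorem isStarProjection_rankOneCompl {v : HSum H} (hv : ‖v‖ = 1) :
    IsStarProjection (rankOneCompl v) := by
  have h := (isStarProjection_rankOne_self (𝕜 := ℂ) hv).one_sub
  exact ⟨Subtype.ext h.isIdempotentElem, Subtype.ext h.isSelfAdjoint⟩

theorem rankOneCompl_apply (v w : HSum H) :
    (rankOneCompl v : HSum H →L[ℂ] HSum H) w = w - inner ℂ v w • v := rfl

end Blocks

/-! ### The unitary `u` -/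

section Phase

variable {H : Type u} [NormedAddCommGroup H] [InnerProductSpace ℂ H] [CompleteSpace H]

/-- When the real part of an isometry is the scalar `l`, `(C - l)⋆ (C - l) = 1 - 2 l² + l²` is
scalar. -/
theorem norm_sub_smul_sq {G : Type u} [NormedAddCommGroup G] [InnerProductSpace ℂ G]
    [CompleteSpace G] {C : G →L[ℂ] G} (hC : star C * C = 1) {l : ℝ}
    (hl : C + star C = ((2 * l : ℝ) : ℂ) • 1) (k : G) :
    ‖C k - (l : ℂ) • k‖ ^ 2 = (1 - l ^ 2) * ‖k‖ ^ 2 := by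
  have h1 : ‖C k‖ ^ 2 = ‖k‖ ^ 2 := by
    rw [← inner_self_eq_norm_sq (𝕜 := ℂ), ← inner_self_eq_norm_sq (𝕜 := ℂ),
      ← ContinuousLinearMap.adjoint_inner_right, ← ContinuousLinearMap.star_eq_adjoint,
      ← mul_apply_eq_comp, hC]
    rfl
  have h2 : inner ℂ k (C k) + inner ℂ (C k) k = ((2 * l * ‖k‖ ^ 2 : ℝ) : ℂ) := by
    rw [← ContinuousLinearMap.adjoint_inner_right, ← ContinuousLinearMap.star_eq_adjoint,
      ← inner_add_right, ← add_apply, hl, smul_apply, one_apply_eq_self, inner_smul_right,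
      inner_self_eq_norm_sq_to_K]
    push_cast
    rfl
  have h3 : RCLike.re (inner ℂ (C k) k) = l * ‖k‖ ^ 2 := by
    have h4 := congrArg Complex.re h2
    rw [← inner_conj_symm k (C k)] at h4
    simp only [Complex.add_re, Complex.conj_re, Complex.ofReal_re] at h4
    change Complex.re _ = _
    linarith
  rw [norm_sub_sq (𝕜 := ℂ), h1, inner_smul_right, norm_smul, mul_pow, Complex.norm_real,
    Real.norm_eq_abs, sq_abs]
  rw [show RCLike.re ((l : ℂ) * inner ℂ (C k) k) = l * RCLike.re (inner ℂ (C k) k) from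
    Complex.re_ofReal_mul _ _, h3]
  ring

theorem star_phaseOp {p : H →L[ℂ] H} (hp : IsStarProjection p) (θ : ℝ) :
    star (phaseOp p θ) = phaseOp p (-θ) := by
  have h2 : star p = p := hp.isSelfAdjoint
  rw [phaseOp, phaseOp, star_add, star_smul, star_smul, star_sub, star_one, h2]
  simp [← Complex.exp_conj]

theorem phaseOp_mul_star {p : H →L[ℂ] H} (hp : IsStarProjection p) (θ : ℝ) :
    phaseOp p θ * star (phaseOp p θ) = 1 := by
  have h := phaseOp_isometry hp (-θ)
  rwa [star_phaseOp hp, neg_neg, ← star_phaseOp hp] at h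

theorem phaseOp_add_star {p : H →L[ℂ] H} (hp : IsStarProjection p) (θ : ℝ) :
    phaseOp p θ + star (phaseOp p θ) = ((2 * Real.cos θ : ℝ) : ℂ) • 1 := by
  rw [star_phaseOp hp, phaseOp, phaseOp]
  push_cast
  rw [Complex.two_cos]
  simp only [neg_mul, neg_neg]
  module

theorem phaseOp_apply_of_mem {p : H →L[ℂ] H} {ξ : H} (hξ : p ξ = ξ) (θ : ℝ) :
    phaseOp p θ ξ = Complex.exp (θ * Complex.I) • ξ := by
  simp [phaseOp, hξ]

theorem phaseOp_apply_of_mem_compl {p : H →L[ℂ] H} {η : H} (hη : p η = 0) (θ : ℝ) :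
    phaseOp p θ η = Complex.exp (-(θ * Complex.I)) • η := by
  simp [phaseOp, hη]

theorem inner_eq_zero_of_proj {p : H →L[ℂ] H} (hp : IsStarProjection p) {ξ η : H} (hξ : p ξ = ξ)
    (hη : p η = 0) : inner ℂ ξ η = 0 := by
  have h2 : star p = p := hp.isSelfAdjoint
  rw [← hξ, ← h2, ContinuousLinearMap.star_eq_adjoint, ContinuousLinearMap.adjoint_inner_left, hη,
    inner_zero_right]

/-- Take `h = (ξ + η)/√2` with unit vectors `ξ`, `η` from the two ranges, both nearly killed by `K`.
The phases average to `(e^{iθ} + e^{-iθ})/2`, and `u⋆` only multiplies `ξ` and `η` by phases, so `K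
u⋆ h` stays small. -/
theorem exists_mixed_vector {p : H →L[ℂ] H} (hp : IsStarProjection p)
    (hp₁ : ¬ FiniteDimensional ℂ (LinearMap.range (p : H →ₗ[ℂ] H)))
    (hp₂ : ¬ FiniteDimensional ℂ (LinearMap.range ((1 - p : H →L[ℂ] H) : H →ₗ[ℂ] H)))
    (θ : ℝ) {K : H →L[ℂ] H} (hK : IsCompactOperator K) {ε : ℝ} (hε : 0 < ε) :
    ∃ h, ‖h‖ = 1 ∧ inner ℂ h (phaseOp p θ h) = Real.cos θ ∧ ‖K (star (phaseOp p θ) h)‖ < ε := by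
  obtain ⟨ξ, hξ, hξn, hξK⟩ := exists_norm_lt_of_compact hK hp.isIdempotentElem hp₁ (half_pos hε)
  obtain ⟨η, hη, hηn, hηK⟩ := exists_norm_lt_of_compact hK hp.one_sub.isIdempotentElem hp₂
    (half_pos hε)
  have hη' : p η = 0 := by simpa using hη
  have h0 := inner_eq_zero_of_proj hp hξ hη'
  have h0' : inner ℂ η ξ = 0 := inner_eq_zero_symm.1 h0
  have hξξ : inner ℂ ξ ξ = (1 : ℂ) := by rw [inner_self_eq_norm_sq_to_K, hξn]; simp
  have hηη : inner ℂ η η = (1 : ℂ) := by rw [inner_self_eq_norm_sq_to_K, hηn]; simp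
  refine ⟨((√2 : ℝ) : ℂ)⁻¹ • (ξ + η), ?_, ?_, ?_⟩
  · have : ‖((√2 : ℝ) : ℂ)⁻¹ • (ξ + η)‖ ^ 2 = 1 := by
      rw [← inner_self_eq_norm_sq (𝕜 := ℂ), inner_inv_sqrt_two_smul]
      simp only [inner_add_left, inner_add_right, h0, h0', hξξ, hηη]
      norm_num
    exact (pow_eq_one_iff_of_nonneg (norm_nonneg _) two_ne_zero).1 this
  · rw [map_smul, map_add, phaseOp_apply_of_mem hξ, phaseOp_apply_of_mem_compl hη',
      inner_inv_sqrt_two_smul]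
    simp only [inner_add_left, inner_add_right, inner_smul_right, h0, h0', hξξ, hηη]
    rw [Complex.ofReal_cos, Complex.cos]
    simp only [neg_mul]
    ring
  · rw [star_phaseOp hp, map_smul, map_add, phaseOp_apply_of_mem hξ, phaseOp_apply_of_mem_compl hη',
      map_smul, map_add, map_smul, map_smul]
    have hn : ∀ t : ℝ, ‖Complex.exp (t * Complex.I)‖ = 1 := Complex.norm_exp_ofReal_mul_I
    have hn' : ‖Complex.exp (-(((-θ : ℝ) : ℂ) * Complex.I))‖ = 1 := by
      rw [← neg_mul, ← Complex.ofReal_neg]; exact hn _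
    have h3 : ‖((√2 : ℝ) : ℂ)⁻¹‖ ≤ 1 := by
      rw [norm_inv, Complex.norm_real, Real.norm_eq_abs, abs_of_nonneg (Real.sqrt_nonneg 2)]
      exact inv_le_one_of_one_le₀ (Real.one_le_sqrt.2 one_le_two)
    rw [norm_smul]
    refine (mul_le_of_le_one_left (norm_nonneg _) h3).trans_lt ((norm_add_le _ _).trans_lt ?_)
    rw [norm_smul, norm_smul, hn, hn', one_mul, one_mul]
    linarith

/-- Nonzero multiples of `u` are not scalars modulo the compact operators. -/
theorem eq_zero_of_smul_phaseOp_mem {p : H →L[ℂ] H} (hp : IsStarProjection p)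
    (hp₁ : ¬ FiniteDimensional ℂ (LinearMap.range (p : H →ₗ[ℂ] H)))
    (hp₂ : ¬ FiniteDimensional ℂ (LinearMap.range ((1 - p : H →L[ℂ] H) : H →ₗ[ℂ] H)))
    {θ : ℝ} (hθ : Real.sin θ ≠ 0) {l : ℂ} (hl : l • phaseOp p θ ∈ kPlus H) : l = 0 := by
  obtain ⟨K, c, hK, hKc⟩ := hl
  -- On a range of infinite dimension `K` is arbitrarily small at unit vectors, so an eigenvalue `l
  -- e` of `l u` there must be the scalar part `c`. For `p` and `1 - p` this gives `l e^{iθ} = c = l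
  -- e^{-iθ}`.
  have key : ∀ (q : H →L[ℂ] H) (e : ℂ), IsIdempotentElem q →
      ¬ FiniteDimensional ℂ (LinearMap.range (q : H →ₗ[ℂ] H)) →
      (∀ ξ, q ξ = ξ → phaseOp p θ ξ = e • ξ) → l * e = c := by
    intro q e hq hd he
    by_contra hne
    obtain ⟨ξ, hξ, hξn, hξK⟩ := exists_norm_lt_of_compact hK hq hd
      (norm_pos_iff.2 (sub_ne_zero.2 hne))
    have h1 := DFunLike.congr_fun hKc ξ
    rw [smul_apply, he ξ hξ, smul_smul, add_apply, smul_apply, one_apply_eq_self,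
      ← sub_eq_iff_eq_add, ← sub_smul] at h1
    rw [← h1, norm_smul, hξn, mul_one] at hξK
    exact lt_irrefl _ hξK
  have h1 := key p _ hp.isIdempotentElem hp₁ fun ξ hξ => phaseOp_apply_of_mem hξ θ
  have h2 := key (1 - p) _ hp.one_sub.isIdempotentElem hp₂ fun ξ hξ =>
    phaseOp_apply_of_mem_compl (by simpa using hξ) θ
  have h3 : l * (2 * Complex.sin θ * Complex.I) = 0 := by
    rw [Complex.two_sin, mul_assoc, Complex.I_mul_I, mul_neg_one, neg_sub, mul_sub, h1, neg_mul, h2,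
      sub_self]
  have h4 : Complex.sin θ ≠ 0 := by rw [← Complex.ofReal_sin]; exact_mod_cast hθ
  simpa [h4] using h3

end Phase

/-! ### Non-injectivity of `𝒦₊` and complete positivity -/

section Positivity

variable {H : Type u} [NormedAddCommGroup H] [InnerProductSpace ℂ H] [CompleteSpace H]

theorem rankOne_le_of_mem {q : H →L[ℂ] H} (hq : IsStarProjection q) {ξ : H} (hξ : q ξ = ξ)
    (hξn : ‖ξ‖ = 1) : rankOne ℂ ξ ξ ≤ q := by
  have h2 : star q = q := hq.isSelfAdjoint
  have h1 : q * q = q := hq.isIdempotentElem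
  rw [ContinuousLinearMap.le_def]
  refine ContinuousLinearMap.IsPositive.of_isStarProjection ⟨?_, ?_⟩
  · have h3 : q * rankOne ℂ ξ ξ = rankOne ℂ ξ ξ := by
      rw [ContinuousLinearMap.mul_def, comp_rankOne, hξ]
    have h4 : rankOne ℂ ξ ξ * q = rankOne ℂ ξ ξ := by
      rw [ContinuousLinearMap.mul_def, rankOne_comp, ← ContinuousLinearMap.star_eq_adjoint, h2, hξ]
    have h5 : rankOne ℂ ξ ξ * rankOne ℂ ξ ξ = rankOne ℂ ξ ξ := isIdempotentElem_rankOne_self hξn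
    rw [IsIdempotentElem, sub_mul, mul_sub, mul_sub, h1, h3, h4, h5, sub_self, sub_zero]
  · exact hq.isSelfAdjoint.sub (isStarProjection_rankOne_self hξn).isSelfAdjoint

/-- A positive projection fixes the rank one projections below `p` and below `1 - p`. Writing `Φ p =
K + c` and testing where `K` is small, the first family forces `Re c > 3/4` and the second `Re c <
1/4`. -/
theorem not_isInjectiveAlgebra_kPlus {p : H →L[ℂ] H} (hp : IsStarProjection p)
    (hp₁ : ¬ FiniteDimensional ℂ (LinearMap.range (p : H →ₗ[ℂ] H)))
    (hp₂ : ¬ FiniteDimensional ℂ (LinearMap.range ((1 - p : H →L[ℂ] H) : H →ₗ[ℂ] H))) :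
    ¬ IsInjectiveAlgebra (kPlus H) := by
  rintro ⟨Φ, hΦ⟩
  have key : ∀ (q : H →L[ℂ] H) (ξ : H), IsStarProjection q → q ξ = ξ → ‖ξ‖ = 1 →
      1 ≤ RCLike.re (inner ℂ ξ ((Φ q : H →L[ℂ] H) ξ)) := by
    intro q ξ hq hξ hξn
    have h1 : Φ (rankOne ℂ ξ ξ) ≤ Φ q := OrderHomClass.mono Φ (rankOne_le_of_mem hq hξ hξn)
    have h2 : rankOne ℂ ξ ξ ≤ (Φ q : H →L[ℂ] H) := by
      rw [hΦ ⟨rankOne ℂ ξ ξ, mem_kPlus_of_compact (isCompactOperator_rankOne ξ ξ)⟩] at h1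
      exact h1
    have h3 := (ContinuousLinearMap.le_def _ _).1 h2 |>.re_inner_nonneg_right ξ
    rw [sub_apply, rankOne_apply, inner_self_eq_norm_sq_to_K, hξn, inner_sub_right, map_sub] at h3
    have h4 : RCLike.re (inner ℂ ξ ((((1 : ℝ) : ℂ) ^ 2) • ξ)) = (1 : ℝ) := by
      rw [Complex.ofReal_one, one_pow, one_smul, inner_self_eq_norm_sq, hξn, one_pow]
    have h5 := h3
    erw [h4] at h5
    linarith
  obtain ⟨K, c, hK, hKc⟩ := (Φ p).2
  obtain ⟨ξ, hξ, hξn, hξK⟩ := exists_norm_lt_of_compact hK hp.isIdempotentElem hp₁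
    (show (0 : ℝ) < 1 / 4 by norm_num)
  obtain ⟨η, hη, hηn, hηK⟩ := exists_norm_lt_of_compact hK hp.one_sub.isIdempotentElem hp₂
    (show (0 : ℝ) < 1 / 4 by norm_num)
  have hone : (Φ 1 : H →L[ℂ] H) = 1 := congrArg Subtype.val (hΦ 1)
  have h1 := key p ξ hp hξ hξn
  have h2 := key (1 - p) η hp.one_sub hη hηn
  have hc : ∀ v : H, ‖v‖ = 1 → inner ℂ v (c • v) = c := fun v hv => by
    rw [inner_smul_right, inner_self_eq_norm_sq_to_K, hv]; simp
  have hr : ∀ v : H, ‖v‖ = 1 → ‖K v‖ < 1 / 4 → |RCLike.re (inner ℂ v (K v))| < 1 / 4 := by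
    intro v hv hKv
    refine (RCLike.abs_re_le_norm _).trans_lt ((norm_inner_le_norm _ _).trans_lt ?_)
    rwa [hv, one_mul]
  have hξr := abs_lt.1 (hr ξ hξn hξK)
  have hηr := abs_lt.1 (hr η hηn hηK)
  rw [hKc, add_apply, smul_apply, one_apply_eq_self, inner_add_right, map_add, hc ξ hξn] at h1
  rw [map_sub, AddSubgroupClass.coe_sub, hone, hKc, sub_apply, add_apply, smul_apply,
    one_apply_eq_self, inner_sub_right, inner_add_right, map_sub, map_add, hc η hηn,
    inner_self_eq_norm_sq, hηn] at h2
  linarith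

/-! ### Complete positivity of the compressions. -/

theorem exists_eq_star_mul_self {R : Type*} [CStarAlgebra R] [PartialOrder R]
    [StarOrderedRing R] {a : R} (ha : 0 ≤ a) : ∃ b, a = star b * b :=
  CStarAlgebra.nonneg_iff_eq_star_mul_self.1 ha

/-- A positive matrix is `S⋆ S`, and the hypothesis writes its image as a sum of two squares. The
maps `c₀`, `c₁` take values in `B`, so positivity is obtained in the matrices over `B` itself. -/
theorem exists_completelyPositiveMap {A B : Type u} [CStarAlgebra A] [PartialOrder A]
    [StarOrderedRing A] [CStarAlgebra B] [PartialOrder B] [StarOrderedRing B]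
    (φ c₀ c₁ : A →ₗ[ℂ] B)
    (h : ∀ s t, φ (star s * t) = star (c₀ s) * c₀ t + star (c₁ s) * c₁ t) :
    ∃ ψ : CompletelyPositiveMap A B, ψ.toLinearMap = φ := by
  refine ⟨⟨φ, fun k M hM => ?_⟩, rfl⟩
  obtain ⟨S, rfl⟩ := exists_eq_star_mul_self hM
  have : (star S * S).map φ = star (S.map c₀) * S.map c₀ + star (S.map c₁) * S.map c₁ := by
    ext i j
    rw [CStarMatrix.map_apply, CStarMatrix.add_apply, CStarMatrix.mul_apply, CStarMatrix.mul_apply,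
      CStarMatrix.mul_apply, map_sum, ← Finset.sum_add_distrib]
    refine Finset.sum_congr rfl fun l _ => ?_
    simp only [CStarMatrix.star_apply, CStarMatrix.map_apply, h]
  change 0 ≤ (star S * S).map φ
  rw [this]
  exact add_nonneg (star_mul_self_nonneg _) (star_mul_self_nonneg _)

theorem conj_mem_kPlus {u a : H →L[ℂ] H} (hu : star u * u = 1) (ha : a ∈ kPlus H) :
    star u * a * u ∈ kPlus H := by
  obtain ⟨K, c, hK, rfl⟩ := ha
  refine ⟨star u * K * u, c, (hK.clm_comp (star u)).comp_clm u, ?_⟩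
  simp [mul_add, add_mul, hu]

theorem coordProj_comp_zCol (i : Fin 2) (u : H →L[ℂ] H) (a : HSum H →L[ℂ] HSum H) :
    coordProj H i ∘L a ∘L zCol u =
      ((√2 : ℝ) : ℂ)⁻¹ • (entry i 0 a * u + entry i 1 a) := by
  have hcol : zCol u = ((√2 : ℝ) : ℂ)⁻¹ • (coordIncl H 0 ∘L u + coordIncl H 1) := by
    ext h : 1
    apply HSum.ext <;> simp
  rw [hcol]
  ext h
  simp [entry]

theorem isUCP_phiMap {u : H →L[ℂ] H} (hu : star u * u = 1) (hu' : u * star u = 1) :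
    IsUCP (phiMap u hu) := by
  have hz : ContinuousLinearMap.adjoint (zCol u) ∘L zCol u = 1 := by
    refine ContinuousLinearMap.ext fun h => ext_inner_left ℂ fun v => ?_
    rw [ContinuousLinearMap.comp_apply, ContinuousLinearMap.adjoint_inner_right, inner_zCol,
      ← ContinuousLinearMap.adjoint_inner_right, ← ContinuousLinearMap.star_eq_adjoint,
      ← mul_apply_eq_comp, hu, one_apply_eq_self]
    ring
  -- The first coordinate of `a z` contains `a₀₀ u`, which need not lie in `𝒦₊`. The extra factor
  -- `u⋆` repairs this and cancels in the squares because `u u⋆ = 1`.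
  have hmem₀ : ∀ a : matAlg H, star u ∘L coordProj H 0 ∘L a.1 ∘L zCol u ∈ kPlus H := by
    intro a
    rw [coordProj_comp_zCol, ContinuousLinearMap.comp_smul]
    refine (kPlus H).smul_mem ?_ _
    change star u * (entry 0 0 a.1 * u + entry 0 1 a.1) ∈ kPlus H
    rw [mul_add, ← mul_assoc]
    exact add_mem (conj_mem_kPlus hu a.2.1) (mem_kPlus_of_compact (a.2.2.1.clm_comp (star u)))
  have hmem₁ : ∀ a : matAlg H, coordProj H 1 ∘L a.1 ∘L zCol u ∈ kPlus H := by
    intro a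
    rw [coordProj_comp_zCol]
    refine (kPlus H).smul_mem ?_ _
    exact add_mem (mem_kPlus_of_compact (a.2.2.2.1.comp_clm u)) a.2.2.2.2
  refine ⟨Subtype.ext hz, ?_⟩
  refine exists_completelyPositiveMap (phiMap u hu)
    { toFun := fun a => ⟨_, hmem₀ a⟩
      map_add' := fun a b => by ext; simp
      map_smul' := fun c a => by ext; simp }
    { toFun := fun a => ⟨_, hmem₁ a⟩
      map_add' := fun a b => by ext; simp
      map_smul' := fun c a => by ext; simp } fun s t => Subtype.ext ?_
  change ContinuousLinearMap.adjoint (zCol u) ∘L (star s.1 * t.1) ∘L zCol u =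
    star (star u ∘L coordProj H 0 ∘L s.1 ∘L zCol u) * (star u ∘L coordProj H 0 ∘L t.1 ∘L zCol u) +
      star (coordProj H 1 ∘L s.1 ∘L zCol u) * (coordProj H 1 ∘L t.1 ∘L zCol u)
  refine ContinuousLinearMap.ext fun h => ext_inner_left ℂ fun v => ?_
  simp only [ContinuousLinearMap.star_eq_adjoint, ContinuousLinearMap.comp_apply, add_apply,
    mul_apply_eq_comp, ContinuousLinearMap.adjoint_inner_right, inner_add_right]
  rw [← ContinuousLinearMap.star_eq_adjoint, ← mul_apply_eq_comp u, hu', one_apply_eq_self,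
    WithLp.prod_inner_apply, coordProj_zero_apply,
    coordProj_zero_apply, coordProj_one_apply, coordProj_one_apply]
  rfl

end Positivity

/-! ### Consequences of the representation of vectors by `z₁`, `z₂` -/

section LowerBounds

variable {H : Type u} [NormedAddCommGroup H] [InnerProductSpace ℂ H] [CompleteSpace H]
  {B E : Type u} [CStarAlgebra B] [PartialOrder B] [NormedAddCommGroup E]
  [NormedSpace ℂ E] [Module Bᵐᵒᵖ E] [HilbertModule B E] {ρ : OperatorRep B H}

-- Right multiplication by `|w⟩⟨h|` with `‖h‖ = 1` moves evaluation from `h` to `w`, so rank one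
-- coefficients let `w` vary freely.
open HilbertModule in
theorem OperatorRep.inner_map_inner_rankOne {b b' : B} {w w' h h' : H}
    (hb : ρ.π b = rankOne ℂ w h) (hb' : ρ.π b' = rankOne ℂ w' h') (hh : ‖h‖ = 1) (hh' : ‖h'‖ = 1)
    (s s' : E) :
    inner ℂ h (ρ.π (inner B (MulOpposite.op b • s) (MulOpposite.op b' • s')) h') =
      inner ℂ w (ρ.π (inner B s s') w') := by
  have h1 : inner ℂ h h = (1 : ℂ) := by rw [inner_self_eq_norm_sq_to_K, hh]; simp
  have h2 : inner ℂ h' h' = (1 : ℂ) := by rw [inner_self_eq_norm_sq_to_K, hh']; simp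
  rw [inner_op_smul_left, inner_op_smul_right, map_mul, map_mul, map_star, hb, hb',
    ContinuousLinearMap.star_eq_adjoint, mul_apply_eq_comp, mul_apply_eq_comp,
    ContinuousLinearMap.adjoint_inner_right, rankOne_apply, rankOne_apply, h1, h2, one_smul,
    one_smul]

theorem diagUnit_zero_apply_zCol (u : H →L[ℂ] H) (h : H) :
    (diagUnit H 0 : HSum H →L[ℂ] HSum H) (zCol u h) =
      ((√2 : ℝ) : ℂ)⁻¹ • coordIncl H 0 (u h) := by
  rw [coe_diagUnit_zero]
  apply HSum.ext <;> simp

theorem diagUnit_one_apply_zCol (u : H →L[ℂ] H) (h : H) :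
    (diagUnit H 1 : HSum H →L[ℂ] HSum H) (zCol u h) =
      ((√2 : ℝ) : ℂ)⁻¹ • coordIncl H 1 h := by
  rw [coe_diagUnit_one]
  apply HSum.ext <;> simp

theorem inner_coordIncl (i : Fin 2) (v w : H) :
    inner ℂ (coordIncl H i v) (coordIncl H i w) = inner ℂ v w := by
  rw [← ContinuousLinearMap.adjoint_inner_right, adjoint_coordIncl]
  fin_cases i <;> simp

theorem norm_coordIncl (i : Fin 2) (v : H) : ‖coordIncl H i v‖ = ‖v‖ := by
  rw [← sq_eq_sq₀ (norm_nonneg _) (norm_nonneg _), ← inner_self_eq_norm_sq (𝕜 := ℂ),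
    ← inner_self_eq_norm_sq (𝕜 := ℂ), inner_coordIncl]

theorem norm_zCol {u : H →L[ℂ] H} (hu : star u * u = 1) (h : H) : ‖zCol u h‖ = ‖h‖ := by
  rw [← sq_eq_sq₀ (norm_nonneg _) (norm_nonneg _), ← inner_self_eq_norm_sq (𝕜 := ℂ),
    ← inner_self_eq_norm_sq (𝕜 := ℂ), inner_zCol, ← ContinuousLinearMap.adjoint_inner_right,
    ← ContinuousLinearMap.star_eq_adjoint, ← mul_apply_eq_comp, hu, one_apply_eq_self,
    add_self_div_two]

theorem adjoint_zCol_comp {u : H →L[ℂ] H} (hu : star u * u = 1) :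
    ContinuousLinearMap.adjoint (zCol u) ∘L zCol u = 1 := by
  refine ContinuousLinearMap.ext fun h => ext_inner_left ℂ fun v => ?_
  rw [ContinuousLinearMap.comp_apply, ContinuousLinearMap.adjoint_inner_right, inner_zCol,
    ← ContinuousLinearMap.adjoint_inner_right, ← ContinuousLinearMap.star_eq_adjoint,
    ← mul_apply_eq_comp, hu, one_apply_eq_self]
  ring

/-- Scalars are the operators that intertwine all rank one operators. -/
theorem exists_smul_one_of_rankOne [Nontrivial H] {X Y : H →L[ℂ] H}
    (h : ∀ ξ ζ η : H, inner ℂ ζ (X η) • ξ = inner ℂ ζ η • Y ξ) :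
    ∃ l : ℂ, X = l • 1 ∧ Y = l • 1 := by
  obtain ⟨ζ₀, hζ₀⟩ := exists_ne (0 : H)
  have h0 : inner ℂ ζ₀ ζ₀ ≠ (0 : ℂ) := inner_self_ne_zero.2 hζ₀
  have hY : ∀ ξ, Y ξ = (inner ℂ ζ₀ (X ζ₀) / inner ℂ ζ₀ ζ₀) • ξ := fun ξ => by
    rw [div_eq_inv_mul, mul_smul, h ξ ζ₀ ζ₀, smul_smul, inv_mul_cancel₀ h0, one_smul]
  refine ⟨inner ℂ ζ₀ (X ζ₀) / inner ℂ ζ₀ ζ₀, ?_, ContinuousLinearMap.ext fun ξ => hY ξ⟩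
  refine ContinuousLinearMap.ext fun η => ext_inner_left ℂ fun ζ => ?_
  have h1 := h ζ₀ ζ η
  rw [hY, smul_smul, ← sub_eq_zero, ← sub_smul, smul_eq_zero, or_iff_left hζ₀, sub_eq_zero] at h1
  rw [h1, smul_apply, one_apply_eq_self, inner_smul_right, mul_comm]

variable {σ : LeftAction (matAlg H) B E} {x₁ x₂ : E} {u : H →L[ℂ] H}

theorem map_inner_diagUnit (σ : LeftAction (matAlg H) B E) (x₁ x₂ : E) (i : Fin 2) :
    inner B (σ.toAlgHom (diagUnit H i) x₁) (σ.toAlgHom (diagUnit H i) x₂) =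
      inner B (σ.toAlgHom (diagUnit H i) x₁) x₂ := by
  conv_rhs => rw [← diagUnit_mul_self, map_mul, mul_apply_eq_comp, σ.inner_map_left, star_diagUnit]

/-- The off-diagonal element `a = |(ξ, 0)⟩⟨(0, ζ)|` of `𝒜` satisfies `a x₂ = e₀ x₂ |u⋆ ξ⟩⟨ζ|` and
`a⋆ e₀ x₁ = e₁ x₁ |ζ⟩⟨ξ|`. The identity compares the two ways of computing `⟨e₀ x₁, a x₂⟩`. -/
theorem rankOne_mul_map_inner (hu' : u * star u = 1)
    (h₁ : Represents ρ (matAlg H).subtype σ x₁ (zCol 1))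
    (h₂ : Represents ρ (matAlg H).subtype σ x₂ (zCol u)) (ξ ζ : H) :
    rankOne ℂ ξ ζ *
        ρ.π (inner B (σ.toAlgHom (diagUnit H 1) x₁) (σ.toAlgHom (diagUnit H 1) x₂)) =
      ρ.π (inner B (σ.toAlgHom (diagUnit H 0) x₁) (σ.toAlgHom (diagUnit H 0) x₂)) *
        rankOne ℂ (star u ξ) ζ := by
  obtain ⟨b, hb⟩ := ρ.exists_eq (rankOne ℂ (star u ξ) ζ) (isCompactOperator_rankOne _ _)
  obtain ⟨b', hb'⟩ := ρ.exists_eq (rankOne ℂ ζ ξ) (isCompactOperator_rankOne _ _)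
  let a : matAlg H := ⟨rankOne ℂ (coordIncl H 0 ξ) (coordIncl H 1 ζ),
    compact_mem_matAlg (isCompactOperator_rankOne _ _)⟩
  have ha : (star a : matAlg H).1 = rankOne ℂ (coordIncl H 1 ζ) (coordIncl H 0 ξ) := by
    change star (rankOne ℂ (coordIncl H 0 ξ) (coordIncl H 1 ζ)) = _
    rw [ContinuousLinearMap.star_eq_adjoint, adjoint_rankOne]
  have e2 : MulOpposite.op (1 : B) • σ.toAlgHom a x₂ =
      MulOpposite.op b • σ.toAlgHom (diagUnit H 0) x₂ := by
    refine h₂.op_smul_congr ?_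
    rw [map_one, hb]
    ext v : 1
    change rankOne ℂ (coordIncl H 0 ξ) (coordIncl H 1 ζ) (zCol u v) =
      (diagUnit H 0).1 (zCol u (rankOne ℂ (star u ξ) ζ v))
    rw [diagUnit_zero_apply_zCol, rankOne_apply, rankOne_apply, map_smul, ← mul_apply_eq_comp u,
      hu', one_apply_eq_self, ← ContinuousLinearMap.adjoint_inner_right, adjoint_coordIncl,
      coordProj_one_apply, zCol_snd, inner_smul_right, map_smul, smul_smul]
  have e1 : MulOpposite.op (1 : B) • σ.toAlgHom (star a * diagUnit H 0) x₁ =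
      MulOpposite.op b' • σ.toAlgHom (diagUnit H 1) x₁ := by
    refine h₁.op_smul_congr ?_
    rw [map_one, hb']
    ext v : 1
    change (star a : matAlg H).1 ((diagUnit H 0).1 (zCol 1 v)) =
      (diagUnit H 1).1 (zCol 1 (rankOne ℂ ζ ξ v))
    rw [ha, diagUnit_zero_apply_zCol, diagUnit_one_apply_zCol, rankOne_apply, rankOne_apply,
      inner_smul_right, inner_coordIncl, map_smul, smul_smul, one_apply_eq_self]
  rw [MulOpposite.op_one, one_smul] at e1 e2
  have e3 : inner B (σ.toAlgHom (diagUnit H 0) x₁) (σ.toAlgHom a x₂) =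
      inner B (σ.toAlgHom (star a * diagUnit H 0) x₁) x₂ := by
    rw [map_mul, mul_apply_eq_comp, σ.inner_map_left (star a), star_star]
  rw [e1, e2, HilbertModule.inner_op_smul_left, HilbertModule.inner_op_smul_right] at e3
  have hb'' : ρ.π (star b') = rankOne ℂ ξ ζ := by
    rw [map_star, hb', ContinuousLinearMap.star_eq_adjoint, adjoint_rankOne]
  have e4 := (map_mul ρ.π _ _).symm.trans ((congrArg ρ.π e3).trans (map_mul ρ.π _ _))
  rw [hb, hb''] at e4
  rw [map_inner_diagUnit σ x₁ x₂ 1]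
  exact e4.symm

/-- The inner products of vectors that induce `φ₁` and `φ₂` on the same representation. -/
theorem exists_map_inner_eq [Nontrivial H] (hu : star u * u = 1) (hu' : u * star u = 1)
    (h₁ : Represents ρ (matAlg H).subtype σ x₁ (zCol 1))
    (h₂ : Represents ρ (matAlg H).subtype σ x₂ (zCol u)) :
    ∃ l : ℂ, ρ.π (inner B (σ.toAlgHom (diagUnit H 0) x₁) (σ.toAlgHom (diagUnit H 0) x₂)) = l • u ∧
      ρ.π (inner B x₁ x₂) = l • (u + 1) ∧ l.re ≤ 1 / 2 := by
  set X₀ := ρ.π (inner B (σ.toAlgHom (diagUnit H 0) x₁) (σ.toAlgHom (diagUnit H 0) x₂)) with hX₀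
  set X₁ := ρ.π (inner B (σ.toAlgHom (diagUnit H 1) x₁) (σ.toAlgHom (diagUnit H 1) x₂)) with hX₁
  have hsum : ρ.π (inner B x₁ x₂) = X₀ + X₁ := by
    rw [hX₀, hX₁, map_inner_diagUnit, map_inner_diagUnit, ← map_add, ← HilbertModule.inner_add_left,
      ← add_apply, ← map_add,
      diagUnit_add, map_one, one_apply_eq_self]
  have key : ∀ ξ ζ η : H, inner ℂ ζ (X₁ η) • ξ = inner ℂ ζ η • (X₀ * star u) ξ := by
    intro ξ ζ η
    have h := DFunLike.congr_fun (rankOne_mul_map_inner hu' h₁ h₂ ξ ζ) η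
    rw [mul_apply_eq_comp, mul_apply_eq_comp, rankOne_apply, rankOne_apply, map_smul] at h
    exact h
  obtain ⟨l, hl₁, hl₀⟩ := exists_smul_one_of_rankOne key
  have hX : X₀ = l • u := by
    rw [← mul_one X₀, ← hu, ← mul_assoc, hl₀, smul_mul_assoc, one_mul]
  refine ⟨l, hX, by rw [hsum, hX, hl₁, smul_add], ?_⟩
  obtain ⟨v, hv⟩ := exists_norm_eq H zero_le_one
  -- Evaluated at the unit vector `v`, the inner square of `e₁ x₁ - e₁ x₂` is `1/2 - 2 Re l + 1/2`,
  -- whence the bound on `Re l`.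
  have hd := ρ.re_inner_nonneg (σ.toAlgHom (diagUnit H 1) x₁ - σ.toAlgHom (diagUnit H 1) x₂) v
  have hadj := ρ.adjoint_map_inner (σ.toAlgHom (diagUnit H 1) x₁) (σ.toAlgHom (diagUnit H 1) x₂)
  have hvv : inner ℂ v v = (1 : ℂ) := by rw [inner_self_eq_norm_sq_to_K, hv]; simp
  have hhalf : ∀ u' : H →L[ℂ] H, inner ℂ ((diagUnit H 1).1 (zCol u' v))
      ((diagUnit H 1).1 (zCol u' v)) = (1 / 2 : ℂ) := fun u' => by
    rw [diagUnit_one_apply_zCol, inner_inv_sqrt_two_smul, inner_coordIncl, hvv]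
  rw [HilbertModule.inner_sub_left, HilbertModule.inner_sub_right, HilbertModule.inner_sub_right,
    map_sub, map_sub, map_sub, ← hadj, ← hX₁, hl₁, h₁.map_inner_apply, h₂.map_inner_apply] at hd
  simp only [sub_apply, inner_sub_right, ContinuousLinearMap.comp_apply,
    ContinuousLinearMap.adjoint_inner_right] at hd
  change 0 ≤ RCLike.re (inner ℂ ((diagUnit H 1).1 (zCol 1 v)) ((diagUnit H 1).1 (zCol 1 v)) -
    inner ℂ v (l • v) - (inner ℂ (l • v) v -
      inner ℂ ((diagUnit H 1).1 (zCol u v)) ((diagUnit H 1).1 (zCol u v)))) at hd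
  rw [hhalf, hhalf, inner_smul_right, inner_smul_left, hvv] at hd
  simp only [RCLike.re_to_complex, Complex.sub_re, mul_one, Complex.conj_re] at hd
  norm_num at hd
  linarith

theorem norm_sub_sq_of_represents (h₁ : ρ.π (inner B x₁ x₁) = 1) (h₂ : ρ.π (inner B x₂ x₂) = 1) :
    ‖x₁ - x₂‖ ^ 2 = ‖(2 : ℂ) • (1 : H →L[ℂ] H) -
      (ρ.π (inner B x₁ x₂) + star (ρ.π (inner B x₁ x₂)))‖ := by
  rw [ρ.norm_sq, HilbertModule.inner_sub_left, HilbertModule.inner_sub_right,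
    HilbertModule.inner_sub_right, map_sub, map_sub, map_sub, h₁, h₂,
    ContinuousLinearMap.star_eq_adjoint, ρ.adjoint_map_inner]
  congr 1
  module

theorem Represents.map_inner_self {x : E} {z : H →L[ℂ] HSum H}
    (hx : Represents ρ (matAlg H).subtype σ x z) (hz : ContinuousLinearMap.adjoint z ∘L z = 1) :
    ρ.π (inner B x x) = 1 := by
  have h := hx 1
  rw [map_one, map_one, one_apply_eq_self] at h
  exact h.trans hz

end LowerBounds

/-! ### Lower bounds for the completely bounded norm of a difference -/

section CbLowerBounds

variable {H : Type u} [NormedAddCommGroup H] [InnerProductSpace ℂ H] [CompleteSpace H]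
  {B E : Type u} [CStarAlgebra B] [PartialOrder B] [NormedAddCommGroup E]
  [NormedSpace ℂ E] [Module Bᵐᵒᵖ E] [HilbertModule B E] {ρ : OperatorRep B H}
  {σ₁ σ₂ : LeftAction (matAlg H) B E} {x : E} {u : H →L[ℂ] H}

theorem norm_apply_of_star_mul_self (hu : star u * u = 1) (h : H) : ‖u h‖ = ‖h‖ := by
  rw [← sq_eq_sq₀ (norm_nonneg _) (norm_nonneg _), ← inner_self_eq_norm_sq (𝕜 := ℂ),
    ← inner_self_eq_norm_sq (𝕜 := ℂ), ← ContinuousLinearMap.adjoint_inner_right,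
    ← ContinuousLinearMap.star_eq_adjoint, ← mul_apply_eq_comp, hu, one_apply_eq_self]

/-- Positivity of `⟨y - f, y - f⟩` bounds `‖y‖` from below by any trial vector `f`, without
projections onto submodules. -/
theorem OperatorRep.two_re_inner_sub_le (ρ : OperatorRep B H) (f y : E) (h : H) :
    2 * RCLike.re (inner ℂ h (ρ.π (inner B f y) h)) - RCLike.re (inner ℂ h (ρ.π (inner B f f) h)) ≤
      ‖y‖ ^ 2 * ‖h‖ ^ 2 := by
  have h1 := ρ.re_inner_nonneg (y - f) h
  have h2 := ρ.re_inner_le y h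
  have h3 : RCLike.re (inner ℂ h (ρ.π (inner B y f) h)) =
      RCLike.re (inner ℂ h (ρ.π (inner B f y) h)) := by
    rw [← ρ.adjoint_map_inner, ContinuousLinearMap.adjoint_inner_right, inner_re_symm]
  rw [HilbertModule.inner_sub_left, HilbertModule.inner_sub_right, HilbertModule.inner_sub_right,
    map_sub, map_sub, map_sub, sub_apply, sub_apply, sub_apply, inner_sub_right, inner_sub_right,
    inner_sub_right, map_sub, map_sub, map_sub, h3] at h1
  linarith

theorem norm_rankOneCompl_sq {v : HSum H} (hv : ‖v‖ = 1) (w : HSum H) :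
    ‖(rankOneCompl v).1 w‖ ^ 2 = ‖w‖ ^ 2 - ‖inner ℂ v w‖ ^ 2 := by
  rw [rankOneCompl_apply, norm_sub_sq (𝕜 := ℂ), inner_smul_right, norm_smul, hv,
    ← inner_conj_symm w v, RCLike.mul_conj]
  norm_cast
  ring

theorem Represents.norm_op_smul_rankOne {σ : LeftAction (matAlg H) B E} {z : H →L[ℂ] HSum H}
    (hx : Represents ρ (matAlg H).subtype σ x z) (a : matAlg H) {b : B} {w h : H}
    (hb : ρ.π b = rankOne ℂ w h) (hh : ‖h‖ = 1) :
    ‖MulOpposite.op b • σ.toAlgHom a x‖ = ‖a.1 (z w)‖ := by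
  rw [hx.norm_op_smul, hb, comp_rankOne, comp_rankOne, norm_rankOne, hh, mul_one]
  rfl

/-- Localised at `h`, the vector `x` is `z₁ h` for `σ₁` and `z₂ h` for `σ₂`. The projection
orthogonal to `z₂ h` kills the latter and leaves norm `√(1 - ((1 + c)/2)²)` of the former. -/
theorem le_cbNorm_of_inner_eq (hu : star u * u = 1)
    (h₁ : Represents ρ (matAlg H).subtype σ₁ x (zCol 1))
    (h₂ : Represents ρ (matAlg H).subtype σ₂ x (zCol u)) {h : H} (hh : ‖h‖ = 1) {c : ℝ}
    (hc : inner ℂ h (u h) = (c : ℂ)) :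
    ENNReal.ofReal √((3 + c) * (1 - c)) ≤
      cbNorm B fun a => σ₁.toAlgHom a - σ₂.toAlgHom a := by
  have hv : ‖zCol u h‖ = 1 := by rw [norm_zCol hu, hh]
  obtain ⟨b, hb⟩ := ρ.exists_eq (rankOne ℂ h h) (isCompactOperator_rankOne _ _)
  have hy : ‖MulOpposite.op b • x‖ ≤ 1 := by
    have h3 := h₂.norm_op_smul_rankOne 1 hb hh
    rw [map_one, one_apply_eq_self] at h3
    rw [h3]
    exact hv.le
  have h0 : σ₂.toAlgHom (rankOneCompl (zCol u h)) (MulOpposite.op b • x) = 0 := by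
    have hvv : inner ℂ (zCol u h) (zCol u h) = (1 : ℂ) := by
      rw [inner_self_eq_norm_sq_to_K, hv]; simp
    rw [σ₂.map_op_smul, ← norm_eq_zero, h₂.norm_op_smul_rankOne _ hb hh, rankOneCompl_apply, hvv,
      one_smul, sub_self, norm_zero]
  refine le_trans (ENNReal.ofReal_le_ofReal ?_)
    (two_mul_norm_le_cbNorm σ₁ σ₂ (isStarProjection_rankOneCompl hv) hy h0)
  rw [σ₁.map_op_smul, h₁.norm_op_smul_rankOne _ hb hh]
  refine Real.sqrt_le_iff.2 ⟨by positivity, ?_⟩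
  have hin : inner ℂ (zCol u h) (zCol 1 h) = (((c + 1) / 2 : ℝ) : ℂ) := by
    rw [inner_zCol, one_apply_eq_self, ← inner_conj_symm (u h), hc, Complex.conj_ofReal,
      inner_self_eq_norm_sq_to_K, hh]
    push_cast
    simp
  rw [mul_pow, norm_rankOneCompl_sq hv, norm_zCol (by simp), hh, hin, Complex.norm_real,
    Real.norm_eq_abs, sq_abs]
  nlinarith

/-- The two inner products add up to `⟨x, σ₂(e₀) x⟩ = u⋆ u / 2`. Hence scalar part `t` in one block
forces `1 - t` in the other. -/
theorem map_inner_diagUnit_one (hu : star u * u = 1)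
    (h₂ : Represents ρ (matAlg H).subtype σ₂ x (zCol u)) :
    ρ.π (inner B (σ₁.toAlgHom (diagUnit H 1) x) (σ₂.toAlgHom (diagUnit H 0) x)) =
      (1 / 2 : ℂ) • 1 -
        ρ.π (inner B (σ₁.toAlgHom (diagUnit H 0) x) (σ₂.toAlgHom (diagUnit H 0) x)) := by
  have h3 : σ₁.toAlgHom (diagUnit H 1) x = x - σ₁.toAlgHom (diagUnit H 0) x := by
    rw [eq_sub_iff_add_eq, add_comm, ← add_apply, ← map_add, diagUnit_add, map_one,
      one_apply_eq_self]
  rw [h3, HilbertModule.inner_sub_left, map_sub]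
  congr 1
  rw [h₂]
  refine ContinuousLinearMap.ext fun g => ext_inner_left ℂ fun k => ?_
  change inner ℂ k (ContinuousLinearMap.adjoint (zCol u) ((diagUnit H 0).1 (zCol u g))) = _
  rw [ContinuousLinearMap.adjoint_inner_right, diagUnit_zero_apply_zCol]
  change inner ℂ (((√2 : ℝ) : ℂ)⁻¹ • column u 1 k) _ = _
  rw [inner_inv_sqrt_two_smul, ← ContinuousLinearMap.adjoint_inner_left, adjoint_coordIncl,
    coordProj_zero_apply, column_fst, smul_apply, inner_smul_right,
    ← ContinuousLinearMap.adjoint_inner_right, ← ContinuousLinearMap.star_eq_adjoint,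
    ← mul_apply_eq_comp, hu]
  ring

theorem two_mul_inner_map_inner (hu : star u * u = 1)
    (h₂ : Represents ρ (matAlg H).subtype σ₂ x (zCol u)) {K : H →L[ℂ] H} {t : ℂ}
    (hK : (2 : ℂ) • ρ.π (inner B (σ₁.toAlgHom (diagUnit H 0) x) (σ₂.toAlgHom (diagUnit H 0) x)) =
      K + t • 1) {h g w₀ w₁ : H} (hh : ‖h‖ = 1) {b b₀ b₁ : B} (hb : ρ.π b = rankOne ℂ g h)
    (hb₀ : ρ.π b₀ = rankOne ℂ w₀ h) (hb₁ : ρ.π b₁ = rankOne ℂ w₁ h) :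
    2 * inner ℂ h (ρ.π (inner B
      (MulOpposite.op b₀ • σ₁.toAlgHom (diagUnit H 0) x +
        MulOpposite.op b₁ • σ₁.toAlgHom (diagUnit H 1) x)
      (MulOpposite.op b • σ₂.toAlgHom (diagUnit H 0) x)) h) =
      inner ℂ w₀ (K g) + inner ℂ w₀ (t • g) + (inner ℂ w₁ ((1 - t) • g) - inner ℂ w₁ (K g)) := by
  rw [HilbertModule.inner_add_left, map_add, add_apply, inner_add_right,
    OperatorRep.inner_map_inner_rankOne hb₀ hb hh hh,
    OperatorRep.inner_map_inner_rankOne hb₁ hb hh hh, map_inner_diagUnit_one hu h₂]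
  generalize ρ.π (inner B (σ₁.toAlgHom (diagUnit H 0) x) (σ₂.toAlgHom (diagUnit H 0) x)) = X at hK ⊢
  obtain rfl : K = (2 : ℂ) • X - t • 1 := eq_sub_of_add_eq hK.symm
  simp only [sub_apply, smul_apply, one_apply_eq_self, inner_sub_right, inner_smul_right]
  ring

theorem two_mul_inner_map_inner_self
    (h₁ : Represents ρ (matAlg H).subtype σ₁ x (zCol 1)) {h w₀ w₁ : H} (hh : ‖h‖ = 1) {b₀ b₁ : B}
    (hb₀ : ρ.π b₀ = rankOne ℂ w₀ h) (hb₁ : ρ.π b₁ = rankOne ℂ w₁ h) {f : E}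
    (hf : f = MulOpposite.op b₀ • σ₁.toAlgHom (diagUnit H 0) x +
        MulOpposite.op b₁ • σ₁.toAlgHom (diagUnit H 1) x) :
    2 * inner ℂ h (ρ.π (inner B f f) h) = inner ℂ w₀ w₀ + inner ℂ w₁ w₁ := by
  have hF : ∀ (i j : Fin 2) (v w : H),
      inner ℂ v (ρ.π (inner B (σ₁.toAlgHom (diagUnit H i) x) (σ₁.toAlgHom (diagUnit H j) x)) w) =
      inner ℂ ((diagUnit H i).1 (zCol 1 v)) ((diagUnit H j).1 (zCol 1 w)) := fun i j v w => by
    rw [h₁.map_inner_apply, ContinuousLinearMap.comp_apply, ContinuousLinearMap.adjoint_inner_right]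
    rfl
  subst hf
  rw [HilbertModule.inner_add_left, HilbertModule.inner_add_right, HilbertModule.inner_add_right,
    map_add, map_add, map_add, add_apply, add_apply, add_apply, inner_add_right, inner_add_right,
    inner_add_right, OperatorRep.inner_map_inner_rankOne hb₀ hb₀ hh hh,
    OperatorRep.inner_map_inner_rankOne hb₀ hb₁ hh hh,
    OperatorRep.inner_map_inner_rankOne hb₁ hb₀ hh hh,
    OperatorRep.inner_map_inner_rankOne hb₁ hb₁ hh hh, hF, hF, hF, hF]
  simp only [diagUnit_zero_apply_zCol, diagUnit_one_apply_zCol, inner_inv_sqrt_two_smul,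
    inner_coordIncl, one_apply_eq_self]
  rw [← ContinuousLinearMap.adjoint_inner_right, adjoint_coordIncl,
    ← ContinuousLinearMap.adjoint_inner_right (coordIncl H 1), adjoint_coordIncl]
  simp only [coordProj_zero_apply, coordProj_one_apply, coordIncl_one_fst, coordIncl_zero_snd,
    inner_zero_right]
  ring

/-- The trial vector has first coordinate along `w₀ ⊥ h` and second coordinate orthogonal to `(h,
0)`, so the projection does not touch it. -/
theorem rankOneCompl_map_eq_self
    (h₁ : Represents ρ (matAlg H).subtype σ₁ x (zCol 1)) {h w₀ : H} (hhw : inner ℂ h w₀ = 0)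
    {b₀ b₁ : B} (hb₀ : ρ.π b₀ = rankOne ℂ w₀ h) {f : E}
    (hf : f = MulOpposite.op b₀ • σ₁.toAlgHom (diagUnit H 0) x +
        MulOpposite.op b₁ • σ₁.toAlgHom (diagUnit H 1) x) :
    σ₁.toAlgHom (rankOneCompl (coordIncl H 0 h)) f = f := by
  have e₀ : MulOpposite.op b₀ • σ₁.toAlgHom (rankOneCompl (coordIncl H 0 h) * diagUnit H 0) x =
      MulOpposite.op b₀ • σ₁.toAlgHom (diagUnit H 0) x := by
    refine h₁.op_smul_congr ?_
    rw [hb₀]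
    ext k : 1
    change (rankOneCompl (coordIncl H 0 h)).1 ((diagUnit H 0).1 (zCol 1 (rankOne ℂ w₀ h k))) =
      (diagUnit H 0).1 (zCol 1 (rankOne ℂ w₀ h k))
    rw [diagUnit_zero_apply_zCol, rankOneCompl_apply, inner_smul_right, inner_coordIncl,
      one_apply_eq_self, rankOne_apply, inner_smul_right, hhw, mul_zero, mul_zero, zero_smul,
      sub_zero]
  have e₁ : MulOpposite.op b₁ • σ₁.toAlgHom (rankOneCompl (coordIncl H 0 h) * diagUnit H 1) x =
      MulOpposite.op b₁ • σ₁.toAlgHom (diagUnit H 1) x := by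
    refine h₁.op_smul_congr ?_
    ext k : 1
    change (rankOneCompl (coordIncl H 0 h)).1 ((diagUnit H 1).1 (zCol 1 (ρ.π b₁ k))) =
      (diagUnit H 1).1 (zCol 1 (ρ.π b₁ k))
    rw [diagUnit_one_apply_zCol, rankOneCompl_apply, inner_smul_right,
      ← ContinuousLinearMap.adjoint_inner_right, adjoint_coordIncl, coordProj_zero_apply,
      coordIncl_one_fst, inner_zero_right, mul_zero, zero_smul, sub_zero]
  rw [map_mul, mul_apply_eq_comp, ← σ₁.map_op_smul] at e₀ e₁
  rw [hf, map_add, e₀, e₁]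

/-- For `σ₂` the test vector is `(h, 0)`, killed by `q = 1 - |(h, 0)⟩⟨(h, 0)|`. For `σ₁` its inner
products with `σ₁(e₀) x` and `σ₁(e₁) x` are governed by `t` and `1 - t` up to `K`, so a definite
part of it survives `q`. -/
theorem exists_le_cbNorm (hu : star u * u = 1) (hu' : u * star u = 1)
    (h₁ : Represents ρ (matAlg H).subtype σ₁ x (zCol 1))
    (h₂ : Represents ρ (matAlg H).subtype σ₂ x (zCol u)) {K : H →L[ℂ] H} {t : ℂ}
    (hK : (2 : ℂ) • ρ.π (inner B (σ₁.toAlgHom (diagUnit H 0) x) (σ₂.toAlgHom (diagUnit H 0) x)) =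
      K + t • 1) {h : H} (hh : ‖h‖ = 1) {c : ℝ} (hc : inner ℂ h (u h) = (c : ℂ)) :
    ∃ r : ℝ, 0 ≤ r ∧
      ENNReal.ofReal (2 * r) ≤ cbNorm B (fun a => σ₁.toAlgHom a - σ₂.toAlgHom a) ∧
      ‖t‖ ^ 2 * (1 - c ^ 2) + ‖1 - t‖ ^ 2 -
        2 * (‖t‖ * (1 + |c|) + ‖1 - t‖) * ‖K (star u h)‖ ≤ r ^ 2 := by
  obtain ⟨g, hg⟩ : ∃ g, g = star u h := ⟨_, rfl⟩
  have hug : u g = h := by rw [hg, ← mul_apply_eq_comp, hu']; rfl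
  have hgn : ‖g‖ = 1 := by rw [← norm_apply_of_star_mul_self hu, hug, hh]
  have hhh : inner ℂ h h = (1 : ℂ) := by rw [inner_self_eq_norm_sq_to_K, hh]; simp
  have hgg : inner ℂ g g = (1 : ℂ) := by rw [inner_self_eq_norm_sq_to_K, hgn]; simp
  have hgh : inner ℂ g h = (c : ℂ) := by
    rw [← hc, hg, ContinuousLinearMap.star_eq_adjoint, ContinuousLinearMap.adjoint_inner_left]
  have hhg : inner ℂ h g = (c : ℂ) := by
    rw [← inner_conj_symm, hgh, Complex.conj_ofReal]
  rw [← hg]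
  -- Apart from `K`, the components of the test vector along `σ₁(e₀) x` and `σ₁(e₁) x` are `t g` and
  -- `(1 - t) g`. The part of `t g` along `h` is removed because `q` kills it.
  obtain ⟨w₀, hw₀⟩ : ∃ w₀, w₀ = t • (g - (c : ℂ) • h) := ⟨_, rfl⟩
  obtain ⟨w₁, hw₁⟩ : ∃ w₁, w₁ = (1 - t) • g := ⟨_, rfl⟩
  have hhw : inner ℂ h w₀ = 0 := by
    rw [hw₀, inner_smul_right, inner_sub_right, inner_smul_right, hhg, hhh, mul_one, sub_self,
      mul_zero]
  have hv : ‖coordIncl H 0 h‖ = 1 := by rw [norm_coordIncl, hh]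
  have hq := isStarProjection_rankOneCompl hv
  obtain ⟨b, hb⟩ := ρ.exists_eq (rankOne ℂ g h) (isCompactOperator_rankOne _ _)
  obtain ⟨b₀, hb₀⟩ := ρ.exists_eq (rankOne ℂ w₀ h) (isCompactOperator_rankOne _ _)
  obtain ⟨b₁, hb₁⟩ := ρ.exists_eq (rankOne ℂ w₁ h) (isCompactOperator_rankOne _ _)
  obtain ⟨y, hy⟩ : ∃ y, y = MulOpposite.op b • σ₂.toAlgHom (diagUnit H 0) x := ⟨_, rfl⟩
  obtain ⟨f, hf⟩ : ∃ f, f = MulOpposite.op b₀ • σ₁.toAlgHom (diagUnit H 0) x +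
    MulOpposite.op b₁ • σ₁.toAlgHom (diagUnit H 1) x := ⟨_, rfl⟩
  -- In the picture of `σ₂`, `y` is `(u g, 0)/√2 = (h, 0)/√2`, hence the factor `√2`.
  have hyn : ‖((√2 : ℝ) : ℂ) • y‖ ≤ 1 := by
    have hs : ‖((√2 : ℝ) : ℂ)‖ * ‖((√2 : ℝ) : ℂ)⁻¹‖ = 1 := by
      rw [← norm_mul, mul_inv_cancel₀ (by simp), norm_one]
    rw [hy, norm_smul, h₂.norm_op_smul_rankOne _ hb hh, diagUnit_zero_apply_zCol, hug, norm_smul,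
      ← mul_assoc, hs, hv, one_mul]
  have hy0 : σ₂.toAlgHom (rankOneCompl (coordIncl H 0 h)) (((√2 : ℝ) : ℂ) • y) = 0 := by
    have h3 : MulOpposite.op b •
        σ₂.toAlgHom (rankOneCompl (coordIncl H 0 h) * diagUnit H 0) x = 0 := by
      rw [← norm_eq_zero, h₂.norm_op_smul_rankOne _ hb hh]
      change ‖(rankOneCompl (coordIncl H 0 h)).1 ((diagUnit H 0).1 (zCol u g))‖ = 0
      rw [diagUnit_zero_apply_zCol, hug, map_smul, rankOneCompl_apply, inner_self_eq_norm_sq_to_K,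
        hv]
      simp
    rw [map_mul, mul_apply_eq_comp, ← σ₂.map_op_smul] at h3
    rw [hy, map_smul, h3, smul_zero]
  refine ⟨_, norm_nonneg _, two_mul_norm_le_cbNorm σ₁ σ₂ hq hyn hy0, ?_⟩
  rw [map_smul, norm_smul, mul_pow, Complex.norm_real, Real.norm_eq_abs, sq_abs,
    Real.sq_sqrt zero_le_two]
  have hin := ρ.two_re_inner_sub_le f (σ₁.toAlgHom (rankOneCompl (coordIncl H 0 h)) y) h
  rw [hh, one_pow, mul_one] at hin
  have hfY : inner B f (σ₁.toAlgHom (rankOneCompl (coordIncl H 0 h)) y) = inner B f y := by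
    have h3 := σ₁.inner_map_left (rankOneCompl (coordIncl H 0 h)) f y
    rw [hq.isSelfAdjoint.star_eq, rankOneCompl_map_eq_self h₁ hhw hb₀ hf] at h3
    exact h3.symm
  -- Up to the terms with `K g`, both `2 ⟨f, y⟩` and `2 ⟨f, f⟩` equal `|t|² (1 - c²) + |1 - t|²` at
  -- `h`, so the trial bound returns this same value.
  have hfy := two_mul_inner_map_inner hu h₂ hK hh hb hb₀ hb₁
  rw [← hf, ← hy, ← hfY] at hfy
  have hff := two_mul_inner_map_inner_self h₁ hh hb₀ hb₁ hf
  have hw₁g : inner ℂ w₁ ((1 - t) • g) = ((‖1 - t‖ ^ 2 : ℝ) : ℂ) := by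
    rw [hw₁, inner_smul_left, inner_smul_right, hgg, mul_one, Complex.conj_mul']
    norm_cast
  have hw₀g : inner ℂ w₀ (t • g) = ((‖t‖ ^ 2 * (1 - c ^ 2) : ℝ) : ℂ) := by
    rw [hw₀, inner_smul_left, inner_smul_right, inner_sub_left, inner_smul_left, hgg, hhg,
      Complex.conj_ofReal, ← mul_assoc, Complex.conj_mul']
    push_cast
    ring
  have hw₀w₀ : inner ℂ w₀ w₀ = ((‖t‖ ^ 2 * (1 - c ^ 2) : ℝ) : ℂ) := by
    have h3 : inner ℂ w₀ h = 0 := inner_eq_zero_symm.1 hhw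
    have h4 : w₀ = t • g - (t * c) • h := by rw [hw₀, smul_sub, smul_smul]
    have h5 : inner ℂ w₀ w₀ = inner ℂ w₀ (t • g - (t * c) • h) := by rw [← h4]
    rw [h5, inner_sub_right, inner_smul_right w₀ h, h3, mul_zero, sub_zero, hw₀g]
  have hw₁w₁ : inner ℂ w₁ w₁ = ((‖1 - t‖ ^ 2 : ℝ) : ℂ) := by rw [← hw₁g, ← hw₁]
  rw [hw₀g, hw₁g] at hfy
  rw [hw₀w₀, hw₁w₁] at hff
  have hw₀n : ‖w₀‖ ≤ ‖t‖ * (1 + |c|) := by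
    rw [hw₀, norm_smul]
    gcongr
    refine (norm_sub_le _ _).trans ?_
    rw [norm_smul, hh, hgn, Complex.norm_real, Real.norm_eq_abs, mul_one]
  have hw₁n : ‖w₁‖ ≤ ‖1 - t‖ := by rw [hw₁, norm_smul, hgn, mul_one]
  have i₀ := (norm_inner_le_norm (𝕜 := ℂ) w₀ (K g)).trans
    (mul_le_mul_of_nonneg_right hw₀n (norm_nonneg _))
  have i₁ := (norm_inner_le_norm (𝕜 := ℂ) w₁ (K g)).trans
    (mul_le_mul_of_nonneg_right hw₁n (norm_nonneg _))
  have j₀ := (abs_le.1 ((Complex.abs_re_le_norm _).trans i₀)).1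
  have j₁ := (abs_le.1 ((Complex.abs_re_le_norm _).trans i₁)).2
  have k₀ := congrArg Complex.re hfy
  have k₁ := congrArg Complex.re hff
  simp only [Complex.add_re, Complex.sub_re, Complex.re_ofNat, Complex.mul_re, Complex.im_ofNat,
    zero_mul, sub_zero, Complex.ofReal_re] at k₀ k₁
  simp only [RCLike.re_to_complex] at hin
  linarith

end CbLowerBounds

/-! ### Lower bounds for the two distances -/

section LowerBounds

variable {H : Type u} [NormedAddCommGroup H] [InnerProductSpace ℂ H] [CompleteSpace H]
  {B : Type u} [CStarAlgebra B] [PartialOrder B] [StarOrderedRing B] {ρ : OperatorRep B H}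
  {u : H →L[ℂ] H}

theorem OperatorRep.le_repMetric_of_inner_eq (ρ : OperatorRep B H) {φ₁ φ₂ : matAlg H →ₗ[ℂ] B}
    (hu : star u * u = 1)
    (h₁ : ∀ a : matAlg H, ρ.π (φ₁ a) = ContinuousLinearMap.adjoint (zCol 1) ∘L a.1 ∘L zCol 1)
    (h₂ : ∀ a : matAlg H, ρ.π (φ₂ a) = ContinuousLinearMap.adjoint (zCol u) ∘L a.1 ∘L zCol u)
    {h : H} (hh : ‖h‖ = 1) {c : ℝ} (hc : inner ℂ h (u h) = (c : ℂ)) :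
    ENNReal.ofReal √((3 + c) * (1 - c)) ≤ repMetric φ₁ φ₂ :=
  le_iInf fun R => le_cbNorm_of_inner_eq (ρ := ρ) hu
    (fun a => (congrArg ρ.π (R.map₁ a)).symm.trans (h₁ a))
    (fun a => (congrArg ρ.π (R.map₂ a)).symm.trans (h₂ a)) hh hc

theorem OperatorRep.le_buresDist_of_inner_eq [Nontrivial H] (ρ : OperatorRep B H)
    {φ₁ φ₂ : matAlg H →ₗ[ℂ] B} (hu : star u * u = 1) (hu' : u * star u = 1)
    (h₁ : ∀ a : matAlg H, ρ.π (φ₁ a) = ContinuousLinearMap.adjoint (zCol 1) ∘L a.1 ∘L zCol 1)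
    (h₂ : ∀ a : matAlg H, ρ.π (φ₂ a) = ContinuousLinearMap.adjoint (zCol u) ∘L a.1 ∘L zCol u)
    {h : H} (hh : ‖h‖ = 1) {c : ℝ} (hc₀ : 0 ≤ 1 + c) (hc : inner ℂ h (u h) = (c : ℂ)) :
    ENNReal.ofReal √(1 - c) ≤ buresDist φ₁ φ₂ := by
  refine le_iInf fun R => ENNReal.ofReal_le_ofReal (Real.sqrt_le_iff.2 ⟨norm_nonneg _, ?_⟩)
  have r₁ : Represents ρ (matAlg H).subtype R.σ R.x₁ (zCol 1) :=
    fun a => (congrArg ρ.π (R.map₁ a)).symm.trans (h₁ a)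
  have r₂ : Represents ρ (matAlg H).subtype R.σ R.x₂ (zCol u) :=
    fun a => (congrArg ρ.π (R.map₂ a)).symm.trans (h₂ a)
  obtain ⟨l, -, hl, hl'⟩ := exists_map_inner_eq hu hu' r₁ r₂
  have hhh : inner ℂ h h = (1 : ℂ) := by rw [inner_self_eq_norm_sq_to_K, hh]; simp
  have e₁ : inner ℂ h (ρ.π (inner B R.x₁ R.x₂) h) = l * (c + 1) := by
    rw [hl, smul_apply, add_apply, one_apply_eq_self, inner_smul_right, inner_add_right, hc, hhh]
  rw [norm_sub_sq_of_represents (r₁.map_inner_self (adjoint_zCol_comp (by simp)))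
    (r₂.map_inner_self (adjoint_zCol_comp hu))]
  generalize ρ.π (inner B R.x₁ R.x₂) = S at e₁
  refine le_trans ?_ ((re_inner_apply_le _ h).trans_eq (by rw [hh, one_pow, mul_one]))
  have e₂ : inner ℂ h (star S h) = starRingEnd ℂ (l * (c + 1)) := by
    rw [ContinuousLinearMap.star_eq_adjoint, ContinuousLinearMap.adjoint_inner_right,
      ← inner_conj_symm, e₁]
  -- The real part is `2 - 2 (1 + c) Re l`, and `Re l ≤ 1/2` makes it at least `1 - c`.
  rw [sub_apply, add_apply, smul_apply, one_apply_eq_self, inner_sub_right, inner_add_right,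
    inner_smul_right, hhh, e₁, e₂]
  simp
  nlinarith

/-! ### Lower bounds that depend on the scalar part modulo compact operators. -/

variable {φ₁ φ₂ : matAlg H →ₗ[ℂ] kPlus H} {p : H →L[ℂ] H} {θ : ℝ}

/-- The minimum is attained at the real value `t = 1/(1 + s²)`; the square used at the end measures
the deviation of `‖t‖` from it. -/
theorem div_one_add_sq_le (t : ℂ) (s : ℝ) :
    s ^ 2 / (1 + s ^ 2) ≤ ‖t‖ ^ 2 * s ^ 2 + ‖1 - t‖ ^ 2 := by
  have h1 : 1 - ‖t‖ ≤ ‖1 - t‖ := by simpa using norm_sub_norm_le (1 : ℂ) t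
  have h2 : (1 - ‖t‖) ^ 2 ≤ ‖1 - t‖ ^ 2 := by
    refine sq_le_sq' ?_ h1
    have := norm_sub_norm_le t (1 : ℂ)
    rw [norm_sub_rev, norm_one] at this
    linarith
  rw [div_le_iff₀ (by positivity)]
  nlinarith [sq_nonneg (‖t‖ * (1 + s ^ 2) - 1), mul_le_mul_of_nonneg_right h2
    (by positivity : 0 ≤ 1 + s ^ 2)]

/-- Here `t` and `M` are fixed by the representation tuple while the test vector varies with `ε`, so
the error `M κ` disappears in the limit. -/
theorem ofReal_le_of_forall_exists {D : ℝ≥0∞} {t : ℂ} {s M : ℝ} (hM : 0 ≤ M)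
    (h : ∀ ε > 0, ∃ r κ : ℝ, 0 ≤ r ∧ κ < ε ∧ ENNReal.ofReal (2 * r) ≤ D ∧
      ‖t‖ ^ 2 * s ^ 2 + ‖1 - t‖ ^ 2 - M * κ ≤ r ^ 2) :
    ENNReal.ofReal (2 * s / √(1 + s ^ 2)) ≤ D := by
  by_contra! hlt
  have hD : D ≠ ⊤ := hlt.ne_top
  have hle : ‖t‖ ^ 2 * s ^ 2 + ‖1 - t‖ ^ 2 ≤ (D.toReal / 2) ^ 2 := by
    refine le_of_forall_pos_le_add fun ε hε => ?_
    obtain ⟨r, κ, hr, hκ, hrD, hr'⟩ := h (ε / (M + 1)) (by positivity)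
    have h3 : 2 * r ≤ D.toReal := by
      rwa [ENNReal.ofReal_le_iff_le_toReal hD] at hrD
    have h4 : M * κ ≤ ε := by
      refine (mul_le_mul_of_nonneg_left hκ.le hM).trans ?_
      rw [mul_div_assoc', div_le_iff₀ (by positivity)]
      nlinarith
    have h6 : r ^ 2 ≤ (D.toReal / 2) ^ 2 := by gcongr; linarith
    linarith
  have hlt' := (ENNReal.lt_ofReal_iff_toReal_lt hD).1 hlt
  have h7 : (D.toReal / 2) ^ 2 < (s / √(1 + s ^ 2)) ^ 2 := by
    refine pow_lt_pow_left₀ ?_ (by positivity) two_ne_zero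
    rw [mul_div_assoc] at hlt'
    linarith
  rw [div_pow s, Real.sq_sqrt (by positivity)] at h7
  linarith [div_one_add_sq_le t s]

theorem le_cbNorm_of_isCompactOperator {E : Type u} [NormedAddCommGroup E] [NormedSpace ℂ E]
    [Module Bᵐᵒᵖ E] [HilbertModule B E] {σ₁ σ₂ : LeftAction (matAlg H) B E} {x : E}
    (hp : IsStarProjection p)
    (hp₁ : ¬ FiniteDimensional ℂ (LinearMap.range (p : H →ₗ[ℂ] H)))
    (hp₂ : ¬ FiniteDimensional ℂ (LinearMap.range ((1 - p : H →L[ℂ] H) : H →ₗ[ℂ] H)))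
    (r₁ : Represents ρ (matAlg H).subtype σ₁ x (zCol 1))
    (r₂ : Represents ρ (matAlg H).subtype σ₂ x (zCol (phaseOp p θ))) {K : H →L[ℂ] H}
    (hK : IsCompactOperator K) {t : ℂ}
    (ht : (2 : ℂ) • ρ.π (inner B (σ₁.toAlgHom (diagUnit H 0) x) (σ₂.toAlgHom (diagUnit H 0) x)) =
      K + t • 1) :
    ENNReal.ofReal (2 * Real.sin θ / √(1 + Real.sin θ ^ 2)) ≤
      cbNorm B fun a => σ₁.toAlgHom a - σ₂.toAlgHom a := by
  refine ofReal_le_of_forall_exists (t := t)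
    (M := 2 * (‖t‖ * (1 + |Real.cos θ|) + ‖1 - t‖)) (by positivity) fun ε hε => ?_
  obtain ⟨h, hh, hc, hKh⟩ := exists_mixed_vector hp hp₁ hp₂ θ hK hε
  obtain ⟨r, hr, hrD, hr'⟩ := exists_le_cbNorm (phaseOp_isometry hp θ) (phaseOp_mul_star hp θ)
    r₁ r₂ ht hh hc
  rw [← Real.sin_sq] at hr'
  exact ⟨r, _, hr, hKh, hrD, hr'⟩

theorem le_repMetric_kPlus (hp : IsStarProjection p)
    (hp₁ : ¬ FiniteDimensional ℂ (LinearMap.range (p : H →ₗ[ℂ] H)))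
    (hp₂ : ¬ FiniteDimensional ℂ (LinearMap.range ((1 - p : H →L[ℂ] H) : H →ₗ[ℂ] H)))
    (h₁ : ∀ a : matAlg H, (φ₁ a).1 = ContinuousLinearMap.adjoint (zCol 1) ∘L a.1 ∘L zCol 1)
    (h₂ : ∀ a : matAlg H, (φ₂ a).1 =
      ContinuousLinearMap.adjoint (zCol (phaseOp p θ)) ∘L a.1 ∘L zCol (phaseOp p θ)) :
    ENNReal.ofReal (2 * Real.sin θ / √(1 + Real.sin θ ^ 2)) ≤ repMetric φ₁ φ₂ := by
  refine le_iInf fun R => ?_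
  -- This is where `B = 𝒦₊` matters: the inner product has a scalar part. Over `B(H)` there is no
  -- such decomposition.
  obtain ⟨K, t, hK, ht⟩ := (kPlus H).smul_mem (inner (kPlus H)
    (R.σ₁.toAlgHom (diagUnit H 0) R.x) (R.σ₂.toAlgHom (diagUnit H 0) R.x)).2 (2 : ℂ)
  exact le_cbNorm_of_isCompactOperator (ρ := kPlusRep H) hp hp₁ hp₂
    (fun a => (congrArg (kPlusRep H).π (R.map₁ a)).symm.trans (h₁ a))
    (fun a => (congrArg (kPlusRep H).π (R.map₂ a)).symm.trans (h₂ a)) hK ht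

theorem le_buresDist_kPlus [Nontrivial H] (hp : IsStarProjection p)
    (hp₁ : ¬ FiniteDimensional ℂ (LinearMap.range (p : H →ₗ[ℂ] H)))
    (hp₂ : ¬ FiniteDimensional ℂ (LinearMap.range ((1 - p : H →L[ℂ] H) : H →ₗ[ℂ] H)))
    (hθ : Real.sin θ ≠ 0)
    (h₁ : ∀ a : matAlg H, (φ₁ a).1 = ContinuousLinearMap.adjoint (zCol 1) ∘L a.1 ∘L zCol 1)
    (h₂ : ∀ a : matAlg H, (φ₂ a).1 =
      ContinuousLinearMap.adjoint (zCol (phaseOp p θ)) ∘L a.1 ∘L zCol (phaseOp p θ)) :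
    ENNReal.ofReal √2 ≤ buresDist φ₁ φ₂ := by
  refine le_iInf fun R => ENNReal.ofReal_le_ofReal (Real.sqrt_le_iff.2 ⟨norm_nonneg _, ?_⟩)
  have r₁ : Represents (kPlusRep H) (matAlg H).subtype R.σ R.x₁ (zCol 1) :=
    fun a => (congrArg (kPlusRep H).π (R.map₁ a)).symm.trans (h₁ a)
  have r₂ : Represents (kPlusRep H) (matAlg H).subtype R.σ R.x₂ (zCol (phaseOp p θ)) :=
    fun a => (congrArg (kPlusRep H).π (R.map₂ a)).symm.trans (h₂ a)
  obtain ⟨l, hl₀, hl, -⟩ := exists_map_inner_eq (phaseOp_isometry hp θ) (phaseOp_mul_star hp θ)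
    r₁ r₂
  -- The inner product `l u` is an element of `𝒦₊`, so `l = 0` and `x₁`, `x₂` are orthogonal unit
  -- vectors.
  have hl' : l = 0 := eq_zero_of_smul_phaseOp_mem hp hp₁ hp₂ hθ (hl₀ ▸ Subtype.prop _)
  rw [norm_sub_sq_of_represents (r₁.map_inner_self (adjoint_zCol_comp (by simp)))
    (r₂.map_inner_self (adjoint_zCol_comp (phaseOp_isometry hp θ))), hl, hl']
  simp [norm_smul]

end LowerBounds

/-! ### Column modules over `B(H)` and `𝒦₊` -/

section ColumnModules

variable {H : Type u} [NormedAddCommGroup H] [InnerProductSpace ℂ H] [CompleteSpace H]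
  {G : Type u} [NormedAddCommGroup G] [InnerProductSpace ℂ G] [CompleteSpace G]

/-- All operators from `H` to `G`, as a Hilbert `B(H)`-module. -/
noncomputable def fullColumn (H G : Type u) [NormedAddCommGroup H] [InnerProductSpace ℂ H]
    [CompleteSpace H] [NormedAddCommGroup G] [InnerProductSpace ℂ G] [CompleteSpace G] :
    ColumnModule (fullRep H) G where
  M := ⊤
  isClosed := isClosed_univ
  comp_mem _ _ _ := trivial
  inner_mem S _ T _ := ⟨ContinuousLinearMap.adjoint S ∘L T, rfl⟩

/-- The operators from `H` to `G` whose coordinates are in `𝒦₊`, as a Hilbert `𝒦₊`-module. -/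
noncomputable def kPlusColumn {ι : Type*} [Fintype ι] (P : ι → G →L[ℂ] H)
    (hP : ∑ i, ContinuousLinearMap.adjoint (P i) ∘L P i = 1) : ColumnModule (kPlusRep H) G where
  M :=
    { carrier := {T | ∀ i, P i ∘L T ∈ kPlus H}
      add_mem' := fun hS hT i => by
        rw [ContinuousLinearMap.comp_add]
        exact add_mem (hS i) (hT i)
      zero_mem' := fun i => by
        rw [ContinuousLinearMap.comp_zero]
        exact zero_mem _
      smul_mem' := fun c T hT i => by
        rw [ContinuousLinearMap.comp_smul]
        exact (kPlus H).smul_mem (hT i) c }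
  isClosed := by
    change IsClosed {T : H →L[ℂ] G | ∀ i, P i ∘L T ∈ kPlus H}
    rw [Set.ofPred_forall]
    exact isClosed_iInter fun i => isClosed_kPlus.preimage (by fun_prop)
  comp_mem T hT b i := mul_mem (hT i) b.2
  inner_mem S hS T hT := by
    refine ⟨⟨∑ i, star (P i ∘L S) * (P i ∘L T), sum_mem fun i _ =>
      mul_mem (star_mem (hS i)) (hT i)⟩, ?_⟩
    change ∑ i, star (P i ∘L S) * (P i ∘L T) = ContinuousLinearMap.adjoint S ∘L T
    -- Inserting the resolution of the identity `∑ P i⋆ P i` expresses `S⋆ T` through the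
    -- coordinates, which lie in `𝒦₊`.
    have h1 : ContinuousLinearMap.adjoint S ∘L T =
        ContinuousLinearMap.adjoint S ∘L (1 : G →L[ℂ] G) ∘L T := rfl
    rw [h1, ← hP]
    ext v
    simp [sum_apply, ContinuousLinearMap.star_eq_adjoint, ContinuousLinearMap.adjoint_comp]

/-- The representation `a ↦ C τ(a) C⋆`. -/
noncomputable def conjHom {A : Type u} [CStarAlgebra A] {C : G →L[ℂ] G}
    (hC : C ∈ unitary (G →L[ℂ] G)) (τ : A →⋆ₐ[ℂ] (G →L[ℂ] G)) : A →⋆ₐ[ℂ] (G →L[ℂ] G) :=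
  (StarAlgEquiv.toStarAlgHom (Unitary.conjStarAlgAut ℂ (G →L[ℂ] G) ⟨C, hC⟩)).comp τ

theorem conjHom_apply {A : Type u} [CStarAlgebra A] {C : G →L[ℂ] G}
    (hC : C ∈ unitary (G →L[ℂ] G)) (τ : A →⋆ₐ[ℂ] (G →L[ℂ] G)) (a : A) :
    conjHom hC τ a = C * τ a * star C := rfl

/-- The direct sum of two representations. -/
noncomputable def diagHom {A : Type u} [CStarAlgebra A] (τ₁ τ₂ : A →⋆ₐ[ℂ] (G →L[ℂ] G)) :
    A →⋆ₐ[ℂ] (HSum G →L[ℂ] HSum G) where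
  toFun a := blockOp (τ₁ a) 0 0 (τ₂ a)
  map_one' := by rw [map_one, map_one, blockOp_one]
  map_mul' a b := by rw [blockOp_mul]; simp
  map_zero' := by rw [map_zero, map_zero]; ext v : 1; apply HSum.ext <;> simp
  map_add' a b := by rw [blockOp_add]; simp
  commutes' c := by
    rw [AlgHomClass.commutes, AlgHomClass.commutes]
    ext v : 1
    apply HSum.ext <;> simp [Algebra.algebraMap_eq_smul_one]
  map_star' a := by rw [star_blockOp]; simp [map_star]

theorem diagHom_apply {A : Type u} [CStarAlgebra A] (τ₁ τ₂ : A →⋆ₐ[ℂ] (G →L[ℂ] G)) (a : A) :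
    diagHom τ₁ τ₂ a = blockOp (τ₁ a) 0 0 (τ₂ a) := rfl

theorem adjoint_comp_conj_comp (C a : G →L[ℂ] G) (z : H →L[ℂ] G) :
    ContinuousLinearMap.adjoint z ∘L (C * a * star C) ∘L z =
      ContinuousLinearMap.adjoint (star C ∘L z) ∘L a ∘L (star C ∘L z) := by
  rw [ContinuousLinearMap.adjoint_comp, ContinuousLinearMap.star_eq_adjoint,
    ContinuousLinearMap.adjoint_adjoint]
  rfl

theorem sum_adjoint_coordProj_comp :
    ∑ i, ContinuousLinearMap.adjoint (coordProj H i) ∘L coordProj H i = 1 := by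
  rw [Fin.sum_univ_two, ← adjoint_coordIncl, ← adjoint_coordIncl,
    ContinuousLinearMap.adjoint_adjoint, ContinuousLinearMap.adjoint_adjoint, adjoint_coordIncl,
    adjoint_coordIncl]
  ext v : 1
  apply HSum.ext <;> simp

theorem coordProj_comp_comp (i : Fin 2) (a : HSum H →L[ℂ] HSum H) (T : H →L[ℂ] HSum H) :
    coordProj H i ∘L a ∘L T =
      entry i 0 a * (coordProj H 0 ∘L T) + entry i 1 a * (coordProj H 1 ∘L T) := by
  ext v
  have hv : T v = coordIncl H 0 (T v).fst + coordIncl H 1 (T v).snd := by apply HSum.ext <;> simp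
  rw [ContinuousLinearMap.comp_apply, ContinuousLinearMap.comp_apply, hv]
  simp [entry]

theorem coordProj_comp_comp_mem {a : HSum H →L[ℂ] HSum H} (ha : ∀ i j, entry i j a ∈ kPlus H)
    {T : H →L[ℂ] HSum H} (hT : ∀ i, coordProj H i ∘L T ∈ kPlus H) (i : Fin 2) :
    coordProj H i ∘L a ∘L T ∈ kPlus H := by
  rw [coordProj_comp_comp]
  exact add_mem (mul_mem (ha i 0) (hT 0)) (mul_mem (ha i 1) (hT 1))

theorem entry_mem_kPlus {a : HSum H →L[ℂ] HSum H} (ha : a ∈ matAlg H) (i j : Fin 2) :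
    entry i j a ∈ kPlus H := by
  obtain ⟨h00, h01, h10, h11⟩ := ha
  fin_cases i <;> fin_cases j
  · exact h00
  · exact mem_kPlus_of_compact h01
  · exact mem_kPlus_of_compact h10
  · exact h11

theorem coordProj_comp_zCol_one_mem (i : Fin 2) : coordProj H i ∘L zCol 1 ∈ kPlus H := by
  have h : coordProj H i ∘L zCol 1 = ((√2 : ℝ) : ℂ)⁻¹ • 1 := by
    ext v
    fin_cases i <;> simp
  rw [h]
  exact (kPlus H).smul_mem (one_mem _) _

variable {u : H →L[ℂ] H}

theorem blockOp_conj_mem_unitary (hu : star u * u = 1) (hu' : u * star u = 1) :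
    blockOp (star u) 0 0 1 ∈ unitary (HSum H →L[ℂ] HSum H) := by
  rw [Unitary.mem_iff, star_blockOp, blockOp_mul, blockOp_mul]
  simp [hu, hu', blockOp_one]

theorem star_blockOp_conj_comp_zCol :
    star (blockOp (star u) 0 0 1) ∘L zCol 1 = zCol u := by
  rw [star_blockOp]
  ext v : 1
  apply HSum.ext <;> simp

/-- The stray factors `u` and `u⋆` meet compact off-diagonal entries, and `u⋆ (K + c) u` has the
same scalar part `c`. -/
theorem entry_conj_mem_kPlus (hu : star u * u = 1) {a : HSum H →L[ℂ] HSum H} (ha : a ∈ matAlg H)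
    (i j : Fin 2) :
    entry i j (blockOp (star u) 0 0 1 * a * star (blockOp (star u) 0 0 1)) ∈ kPlus H := by
  rw [star_blockOp, ← blockOp_entry a, blockOp_mul, blockOp_mul]
  obtain ⟨h00, h01, h10, h11⟩ := ha
  rw [entry_blockOp]
  fin_cases i <;> fin_cases j
  · simpa using conj_mem_kPlus hu h00
  · simpa using mem_kPlus_of_compact (h01.clm_comp (star u))
  · simpa using mem_kPlus_of_compact (h10.comp_clm u)
  · simpa using h11

/-- A unitary that takes `(u, 1)` to `(1, 1)`. -/
noncomputable def rotOp (u : H →L[ℂ] H) : HSum H →L[ℂ] HSum H :=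
  blockOp ((2 : ℂ)⁻¹ • (1 + star u)) ((2 : ℂ)⁻¹ • (1 - u)) ((2 : ℂ)⁻¹ • (star u - 1))
    ((2 : ℂ)⁻¹ • (1 + u))

theorem star_rotOp : star (rotOp u) =
    blockOp ((2 : ℂ)⁻¹ • (1 + u)) ((2 : ℂ)⁻¹ • (u - 1)) ((2 : ℂ)⁻¹ • (1 - star u))
      ((2 : ℂ)⁻¹ • (1 + star u)) := by
  rw [rotOp, star_blockOp]
  simp [star_smul]

theorem rotOp_mem_unitary (hu : star u * u = 1) (hu' : u * star u = 1) :
    rotOp u ∈ unitary (HSum H →L[ℂ] HSum H) := by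
  rw [Unitary.mem_iff, star_rotOp, rotOp, blockOp_mul, blockOp_mul, ← blockOp_one]
  simp only [smul_mul_smul_comm, mul_add, add_mul, mul_sub, sub_mul, hu, hu', one_mul, mul_one]
  constructor <;> congr 1 <;> module

/-- The scalar real part `(1 + c)/2` feeds `norm_sub_smul_sq`, and the resulting upper bound meets
`le_cbNorm_of_inner_eq` exactly. -/
theorem rotOp_add_star {c : ℝ} (hc : u + star u = ((2 * c : ℝ) : ℂ) • 1) :
    rotOp u + star (rotOp u) = ((2 * ((1 + c) / 2) : ℝ) : ℂ) • 1 := by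
  have h1 : u = ((2 * c : ℝ) : ℂ) • 1 - star u := eq_sub_of_add_eq hc
  rw [star_rotOp, rotOp, blockOp_add]
  ext v : 1
  have h2 : ∀ w, u w = ((2 * c : ℝ) : ℂ) • w - star u w := fun w => DFunLike.congr_fun h1 w
  apply HSum.ext
  · simp [h2]
    module
  · simp [h2]
    module

theorem star_rotOp_comp_zCol : star (rotOp u) ∘L zCol 1 = zCol u := by
  rw [star_rotOp]
  ext v : 1
  apply HSum.ext
  · simp
    module
  · simp
    module

end ColumnModules

/-! ### Upper bounds for the maps `φ₁`, `φ₂` -/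

section PhiUpperBounds

variable {H : Type u} [NormedAddCommGroup H] [InnerProductSpace ℂ H] [CompleteSpace H]
  {u : H →L[ℂ] H} {c : ℝ}

theorem le_sqrt_mul_norm {F G : Type u} [NormedAddCommGroup F] [NormedAddCommGroup G]
    {v : F} {w : G} {r : ℝ}
    (h : ‖v‖ ^ 2 ≤ r * ‖w‖ ^ 2) : ‖v‖ ≤ √r * ‖w‖ := by
  rw [← Real.sqrt_sq (norm_nonneg w), ← Real.sqrt_mul' _ (sq_nonneg _)]
  exact Real.le_sqrt_of_sq_le h

theorem HSum.norm_sq (v : HSum H) : ‖v‖ ^ 2 = ‖v.fst‖ ^ 2 + ‖v.snd‖ ^ 2 :=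
  WithLp.prod_norm_sq_eq_of_L2 v

theorem norm_zCol_sub_le (hu : star u * u = 1) (hc : u + star u = ((2 * c : ℝ) : ℂ) • 1) :
    ‖zCol 1 - zCol u‖ ≤ √(1 - c) := by
  refine ContinuousLinearMap.opNorm_le_bound _ (Real.sqrt_nonneg _) fun h =>
    le_sqrt_mul_norm (le_of_eq ?_)
  have h1 : inner ℂ (u h) h + inner ℂ h (u h) = ((2 * c * ‖h‖ ^ 2 : ℝ) : ℂ) := by
    rw [← ContinuousLinearMap.adjoint_inner_right, ← ContinuousLinearMap.star_eq_adjoint,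
      ← inner_add_right, add_comm, ← add_apply, hc, smul_apply, one_apply_eq_self,
      inner_smul_right, inner_self_eq_norm_sq_to_K]
    push_cast
    rfl
  have h2 := congrArg Complex.re h1
  rw [Complex.add_re, Complex.ofReal_re] at h2
  rw [sub_apply, norm_sub_sq (𝕜 := ℂ), norm_zCol hu, norm_zCol (by simp), inner_zCol,
    one_apply_eq_self, inner_self_eq_norm_sq_to_K]
  have h3 : (inner ℂ (u h) h).re = (inner ℂ h (u h)).re := by
    rw [← inner_conj_symm, Complex.conj_re]
  simp [← Complex.ofReal_pow]
  linarith

theorem buresDist_full_le {φ₁ φ₂ : matAlg H →ₗ[ℂ] (H →L[ℂ] H)} (hu : star u * u = 1)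
    (hc : u + star u = ((2 * c : ℝ) : ℂ) • 1)
    (h₁ : ∀ a : matAlg H, φ₁ a = ContinuousLinearMap.adjoint (zCol 1) ∘L a.1 ∘L zCol 1)
    (h₂ : ∀ a : matAlg H, φ₂ a = ContinuousLinearMap.adjoint (zCol u) ∘L a.1 ∘L zCol u) :
    buresDist φ₁ φ₂ ≤ ENNReal.ofReal √(1 - c) :=
  ((fullColumn H (HSum H)).buresDist_le (matAlg H).subtype (fun _ _ _ => trivial)
    ⟨zCol 1, trivial⟩ ⟨zCol u, trivial⟩ h₁ h₂).trans
    (ENNReal.ofReal_le_ofReal (norm_zCol_sub_le hu hc))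

theorem repMetric_full_le {φ₁ φ₂ : matAlg H →ₗ[ℂ] (H →L[ℂ] H)} (hu : star u * u = 1)
    (hu' : u * star u = 1) (hc : u + star u = ((2 * c : ℝ) : ℂ) • 1)
    (h₁ : ∀ a : matAlg H, φ₁ a = ContinuousLinearMap.adjoint (zCol 1) ∘L a.1 ∘L zCol 1)
    (h₂ : ∀ a : matAlg H, φ₂ a = ContinuousLinearMap.adjoint (zCol u) ∘L a.1 ∘L zCol u) :
    repMetric φ₁ φ₂ ≤ ENNReal.ofReal √((3 + c) * (1 - c)) := by
  have hC := rotOp_mem_unitary hu hu'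
  have h := (fullColumn H (HSum H)).repMetric_le (matAlg H).subtype
    (conjHom hC (matAlg H).subtype) (fun _ _ _ => trivial) (fun _ _ _ => trivial) hC
    (fun _ => rfl) (((1 + c) / 2 : ℝ) : ℂ) (Real.sqrt_nonneg (1 - ((1 + c) / 2) ^ 2))
    (fun k => le_sqrt_mul_norm
      (norm_sub_smul_sq (Unitary.star_mul_self_of_mem hC) (rotOp_add_star hc) k).le)
    ⟨zCol 1, trivial⟩ (adjoint_zCol_comp (by simp)) h₁ fun a => by
      refine (h₂ a).trans ?_
      rw [conjHom_apply, adjoint_comp_conj_comp, star_rotOp_comp_zCol]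
      rfl
  refine h.trans_eq (congrArg _ ?_)
  rw [← Real.sqrt_sq (zero_le_two (α := ℝ)), ← Real.sqrt_mul (sq_nonneg _),
    Real.sqrt_sq (zero_le_two (α := ℝ))]
  congr 1
  ring

/-- The block `u⋆ - c` has the stated norm by `norm_sub_smul_sq`; the other block contributes `1 -
c`, which is no larger since `0 ≤ c ≤ 1`. -/
theorem norm_blockOp_conj_sub_le (hu' : u * star u = 1)
    (hc : u + star u = ((2 * c : ℝ) : ℂ) • 1) (hc₀ : 0 ≤ c) (hc₁ : c ≤ 1) (k : HSum H) :
    ‖blockOp (star u) 0 0 1 k - (c : ℂ) • k‖ ≤ √(1 - c ^ 2) * ‖k‖ := by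
  refine le_sqrt_mul_norm ?_
  rw [HSum.norm_sq, HSum.norm_sq, mul_add]
  refine add_le_add (le_of_eq ?_) ?_
  · rw [← norm_sub_smul_sq (C := star u) (by rwa [star_star]) (by rw [star_star, add_comm, hc])]
    simp
  · have h1 : (blockOp (star u) 0 0 1 k - (c : ℂ) • k).snd = ((1 - c : ℝ) : ℂ) • k.snd := by
      simp [sub_smul]
    rw [h1, norm_smul, mul_pow, Complex.norm_real, Real.norm_eq_abs, sq_abs]
    gcongr
    nlinarith

theorem repMetric_kPlus_le {φ₁ φ₂ : matAlg H →ₗ[ℂ] kPlus H} (hu : star u * u = 1)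
    (hu' : u * star u = 1) (hc : u + star u = ((2 * c : ℝ) : ℂ) • 1) (hc₀ : 0 ≤ c) (hc₁ : c ≤ 1)
    (h₁ : ∀ a : matAlg H, (φ₁ a).1 = ContinuousLinearMap.adjoint (zCol 1) ∘L a.1 ∘L zCol 1)
    (h₂ : ∀ a : matAlg H, (φ₂ a).1 = ContinuousLinearMap.adjoint (zCol u) ∘L a.1 ∘L zCol u) :
    repMetric φ₁ φ₂ ≤ ENNReal.ofReal (2 * √(1 - c ^ 2)) := by
  have hC := blockOp_conj_mem_unitary hu hu'
  exact (kPlusColumn (coordProj H) sum_adjoint_coordProj_comp).repMetric_le (matAlg H).subtype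
    (conjHom hC (matAlg H).subtype)
    (fun a T hT => coordProj_comp_comp_mem (entry_mem_kPlus a.2) hT)
    (fun a T hT => coordProj_comp_comp_mem (entry_conj_mem_kPlus hu a.2) hT) hC
    (fun _ => rfl) (c : ℂ) (Real.sqrt_nonneg _)
    (norm_blockOp_conj_sub_le hu' hc hc₀ hc₁)
    ⟨zCol 1, coordProj_comp_zCol_one_mem⟩ (adjoint_zCol_comp (by simp)) h₁ fun a => by
      refine (h₂ a).trans ?_
      rw [conjHom_apply, adjoint_comp_conj_comp, star_blockOp_conj_comp_zCol]
      rfl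

/-! ### The Bures distance over `𝒦₊` through a direct sum of two actions. -/

theorem sum_adjoint_coordProj_coordProj_comp :
    ∑ i : Fin 2 × Fin 2, ContinuousLinearMap.adjoint (coordProj H i.2 ∘L coordProj (HSum H) i.1) ∘L
      (coordProj H i.2 ∘L coordProj (HSum H) i.1) = 1 := by
  have h2 : ∀ v : HSum H, v = coordIncl H 0 v.fst + coordIncl H 1 v.snd := fun v => by
    apply HSum.ext <;> simp
  rw [Fintype.sum_prod_type, Fin.sum_univ_two, Fin.sum_univ_two, Fin.sum_univ_two]
  simp only [ContinuousLinearMap.adjoint_comp, ← adjoint_coordIncl,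
    ContinuousLinearMap.adjoint_adjoint]
  simp only [adjoint_coordIncl]
  ext v : 1
  apply HSum.ext <;> apply HSum.ext <;> simp

theorem adjoint_coordIncl_comp_diagHom {A : Type u} [CStarAlgebra A]
    (τ : Fin 2 → A →⋆ₐ[ℂ] (HSum H →L[ℂ] HSum H)) (i : Fin 2) (z : H →L[ℂ] HSum H) (a : A) :
    ContinuousLinearMap.adjoint (coordIncl (HSum H) i ∘L z) ∘L diagHom (τ 0) (τ 1) a ∘L
      (coordIncl (HSum H) i ∘L z) = ContinuousLinearMap.adjoint z ∘L τ i a ∘L z := by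
  rw [ContinuousLinearMap.adjoint_comp, adjoint_coordIncl, diagHom_apply]
  ext v
  fin_cases i <;> simp

/-- In a direct sum of two actions the vectors sit in different summands, so they are orthogonal and
at distance `√2`. Both summands carry the column `z₁`, whose entries are in `𝒦₊`; in the second one
`u` is moved into the action by conjugation. -/
theorem buresDist_kPlus_le {φ₁ φ₂ : matAlg H →ₗ[ℂ] kPlus H} (hu : star u * u = 1)
    (hu' : u * star u = 1)
    (h₁ : ∀ a : matAlg H, (φ₁ a).1 = ContinuousLinearMap.adjoint (zCol 1) ∘L a.1 ∘L zCol 1)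
    (h₂ : ∀ a : matAlg H, (φ₂ a).1 = ContinuousLinearMap.adjoint (zCol u) ∘L a.1 ∘L zCol u) :
    buresDist φ₁ φ₂ ≤ ENNReal.ofReal √2 := by
  have hC := blockOp_conj_mem_unitary hu hu'
  have hmem : ∀ i k : Fin 2, coordProj (HSum H) i ∘L coordIncl (HSum H) k ∘L zCol 1 =
      if i = k then zCol 1 else 0 := fun i k => by
    ext v : 1
    fin_cases i <;> fin_cases k <;> simp
  have hx : ∀ (k : Fin 2) (i : Fin 2 × Fin 2), (coordProj H i.2 ∘L coordProj (HSum H) i.1) ∘L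
      coordIncl (HSum H) k ∘L zCol 1 ∈ kPlus H := fun k i => by
    rw [ContinuousLinearMap.comp_assoc, hmem]
    split_ifs
    · exact coordProj_comp_zCol_one_mem _
    · rw [ContinuousLinearMap.comp_zero]
      exact zero_mem _
  let τ : Fin 2 → matAlg H →⋆ₐ[ℂ] (HSum H →L[ℂ] HSum H) :=
    ![(matAlg H).subtype, conjHom hC (matAlg H).subtype]
  have hinv : ∀ (k : Fin 2) (a : matAlg H) (T : H →L[ℂ] HSum H),
      (∀ i, coordProj H i ∘L T ∈ kPlus H) → ∀ i, coordProj H i ∘L τ k a ∘L T ∈ kPlus H := by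
    intro k a T hT
    fin_cases k
    · exact coordProj_comp_comp_mem (entry_mem_kPlus a.2) hT
    · exact coordProj_comp_comp_mem (entry_conj_mem_kPlus hu a.2) hT
  have hdiag : ∀ (i : Fin 2) (a : matAlg H) (T : H →L[ℂ] HSum (HSum H)),
      coordProj (HSum H) i ∘L diagHom (τ 0) (τ 1) a ∘L T =
        τ i a ∘L coordProj (HSum H) i ∘L T := fun i a T => by
    rw [diagHom_apply]
    ext v : 1
    fin_cases i <;> simp
  refine ((kPlusColumn (fun i : Fin 2 × Fin 2 => coordProj H i.2 ∘L coordProj (HSum H) i.1)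
    sum_adjoint_coordProj_coordProj_comp).buresDist_le (diagHom (τ 0) (τ 1)) ?_
    ⟨coordIncl (HSum H) 0 ∘L zCol 1, hx 0⟩ ⟨coordIncl (HSum H) 1 ∘L zCol 1, hx 1⟩ ?_ ?_).trans
    (ENNReal.ofReal_le_ofReal ?_)
  · intro a T hT i
    rw [ContinuousLinearMap.comp_assoc, hdiag]
    exact hinv i.1 a (coordProj (HSum H) i.1 ∘L T) (fun j => hT (i.1, j)) i.2
  · exact fun a => (h₁ a).trans (adjoint_coordIncl_comp_diagHom τ 0 _ a).symm
  · intro a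
    refine Eq.trans ?_ (adjoint_coordIncl_comp_diagHom τ 1 _ a).symm
    refine (h₂ a).trans ?_
    change _ = ContinuousLinearMap.adjoint (zCol 1) ∘L conjHom hC (matAlg H).subtype a ∘L zCol 1
    rw [conjHom_apply, adjoint_comp_conj_comp, star_blockOp_conj_comp_zCol]
    rfl
  · refine ContinuousLinearMap.opNorm_le_bound _ (Real.sqrt_nonneg _) fun v =>
      le_sqrt_mul_norm (le_of_eq ?_)
    have hz : ‖zCol 1 v‖ = ‖v‖ := norm_zCol (by simp) v
    change ‖coordIncl (HSum H) 0 (zCol 1 v) - coordIncl (HSum H) 1 (zCol 1 v)‖ ^ 2 = _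
    rw [HSum.norm_sq]
    simp [hz]
    ring

end PhiUpperBounds

theorem mainTheorem11 {H : Type u} [NormedAddCommGroup H] [InnerProductSpace ℂ H]
    [CompleteSpace H] [TopologicalSpace.SeparableSpace H] (hH : ¬ FiniteDimensional ℂ H)
    (p : H →L[ℂ] H) (hp : IsStarProjection p)
    (hp₁ : ¬ FiniteDimensional ℂ (LinearMap.range (p : H →ₗ[ℂ] H)))
    (hp₂ : ¬ FiniteDimensional ℂ (LinearMap.range ((1 - p : H →L[ℂ] H) : H →ₗ[ℂ] H)))
    (θ : ℝ) (hθ₀ : 0 < θ) (hθ₁ : θ < Real.pi / 4) :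
    let ι : kPlus H →ₗ[ℂ] (H →L[ℂ] H) := (kPlus H).subtype.toLinearMap
    let φ₁ : matAlg H →ₗ[ℂ] kPlus H := phiMap 1 (by simp)
    let φ₂ : matAlg H →ₗ[ℂ] kPlus H := phiMap (phaseOp p θ) (phaseOp_isometry hp θ)
    ¬ IsInjectiveAlgebra (kPlus H) ∧
    IsUCP φ₁ ∧ IsUCP φ₂ ∧
    repMetric φ₁ φ₂ ≤ ENNReal.ofReal (2 * Real.sin θ) ∧
    ENNReal.ofReal (2 * Real.sin θ / √(1 + Real.sin θ ^ 2)) ≤ repMetric φ₁ φ₂ ∧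
    repMetric (ι ∘ₗ φ₁) (ι ∘ₗ φ₂) < ENNReal.ofReal (2 * Real.sin θ / √(1 + Real.sin θ ^ 2)) ∧
    buresDist (ι ∘ₗ φ₁) (ι ∘ₗ φ₂) = ENNReal.ofReal √(1 - Real.cos θ) ∧
    repMetric (ι ∘ₗ φ₁) (ι ∘ₗ φ₂) =
      ENNReal.ofReal √((3 + Real.cos θ) * (1 - Real.cos θ)) ∧
    repMetric φ₁ φ₂ ≠ repMetric (ι ∘ₗ φ₁) (ι ∘ₗ φ₂) ∧
    buresDist φ₁ φ₂ = ENNReal.ofReal √2 ∧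
    (repMetric φ₁ φ₂).toReal ≠
      (buresDist φ₁ φ₂).toReal * √(4 - (buresDist φ₁ φ₂).toReal ^ 2) := by
  have hinf : Nontrivial H := by
    by_contra h
    rw [not_nontrivial_iff_subsingleton] at h
    exact hH inferInstance
  intro ι φ₁ φ₂
  have hu := phaseOp_isometry hp θ
  have hu' := phaseOp_mul_star hp θ
  have hc := phaseOp_add_star hp θ
  have hs : 0 < Real.sin θ := Real.sin_pos_of_pos_of_lt_pi hθ₀ (by linarith [Real.pi_pos])
  have hcos : √2 / 2 < Real.cos θ := by
    rw [← Real.cos_pi_div_four]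
    exact Real.cos_lt_cos_of_nonneg_of_le_pi_div_two hθ₀.le (by linarith [Real.pi_pos]) hθ₁
  have hcos₀ : 0 < Real.cos θ := lt_trans (by positivity) hcos
  have hcos₁ : Real.cos θ ≤ 1 := Real.cos_le_one θ
  have hsq := Real.sin_sq_add_cos_sq θ
  have hc2 : 1 / 2 < Real.cos θ ^ 2 := by
    have := pow_lt_pow_left₀ hcos (by positivity) two_ne_zero
    rwa [div_pow, Real.sq_sqrt zero_le_two, show (2 : ℝ) / 2 ^ 2 = 1 / 2 by norm_num] at this
  have hsin : √(1 - Real.cos θ ^ 2) = Real.sin θ := by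
    rw [← Real.sin_sq, Real.sqrt_sq hs.le]
  -- Only `⟨h, u h⟩ = cos θ` is needed for the sharp bounds over `B(H)`, hence `K = 0`.
  obtain ⟨h, hh, hhc, -⟩ := exists_mixed_vector hp hp₁ hp₂ θ (K := 0) isCompactOperator_zero
    one_pos
  have a₁ : ∀ a : matAlg H, (φ₁ a).1 = ContinuousLinearMap.adjoint (zCol 1) ∘L a.1 ∘L zCol 1 :=
    fun _ => rfl
  have a₂ : ∀ a : matAlg H, (φ₂ a).1 =
      ContinuousLinearMap.adjoint (zCol (phaseOp p θ)) ∘L a.1 ∘L zCol (phaseOp p θ) :=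
    fun _ => rfl
  have b₁ : ∀ a : matAlg H, (ι ∘ₗ φ₁) a =
      ContinuousLinearMap.adjoint (zCol 1) ∘L a.1 ∘L zCol 1 := fun _ => rfl
  have b₂ : ∀ a : matAlg H, (ι ∘ₗ φ₂) a =
      ContinuousLinearMap.adjoint (zCol (phaseOp p θ)) ∘L a.1 ∘L zCol (phaseOp p θ) :=
    fun _ => rfl
  have hinj := not_isInjectiveAlgebra_kPlus hp hp₁ hp₂
  have hφ₁ : IsUCP φ₁ := isUCP_phiMap (by simp) (by simp)
  have hφ₂ : IsUCP φ₂ := isUCP_phiMap hu hu'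
  have hγ : repMetric φ₁ φ₂ ≤ ENNReal.ofReal (2 * Real.sin θ) := by
    have := repMetric_kPlus_le hu hu' hc hcos₀.le hcos₁ a₁ a₂
    rwa [hsin] at this
  have hγ' := le_repMetric_kPlus hp hp₁ hp₂ a₁ a₂
  have hγι : repMetric (ι ∘ₗ φ₁) (ι ∘ₗ φ₂) =
      ENNReal.ofReal √((3 + Real.cos θ) * (1 - Real.cos θ)) :=
    le_antisymm (repMetric_full_le hu hu' hc b₁ b₂)
      ((fullRep H).le_repMetric_of_inner_eq hu b₁ b₂ hh hhc)
  have hβι : buresDist (ι ∘ₗ φ₁) (ι ∘ₗ φ₂) = ENNReal.ofReal √(1 - Real.cos θ) :=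
    le_antisymm (buresDist_full_le hu hc b₁ b₂)
      ((fullRep H).le_buresDist_of_inner_eq hu hu' b₁ b₂ hh (by linarith) hhc)
  have hβ : buresDist φ₁ φ₂ = ENNReal.ofReal √2 :=
    le_antisymm (buresDist_kPlus_le hu hu' a₁ a₂) (le_buresDist_kPlus hp hp₁ hp₂ hs.ne' a₁ a₂)
  have hlt : repMetric (ι ∘ₗ φ₁) (ι ∘ₗ φ₂) <
      ENNReal.ofReal (2 * Real.sin θ / √(1 + Real.sin θ ^ 2)) := by
    rw [hγι, ENNReal.ofReal_lt_ofReal_iff (by positivity)]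
    refine (Real.sqrt_lt' (by positivity)).2 ?_
    rw [div_pow, Real.sq_sqrt (by positivity), lt_div_iff₀ (by positivity)]
    have hs2 : Real.sin θ ^ 2 = 1 - Real.cos θ ^ 2 := by linarith
    rw [mul_pow, hs2]
    have hne : 0 < 1 - Real.cos θ := by nlinarith
    -- With `c = cos θ`, the strict inequality `(3 + c)(1 - c)(2 - c²) < 4 (1 - c²)` becomes this
    -- one after division by `1 - c`. It follows from `c² > 1/2` and `c > √2/2`.
    have hpos : 0 < Real.cos θ ^ 3 + 3 * Real.cos θ ^ 2 + 2 * Real.cos θ - 2 := by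
      have : 0 < Real.cos θ ^ 3 := by positivity
      nlinarith
    nlinarith [mul_pos hne hpos]
  refine ⟨hinj, hφ₁, hφ₂, hγ, hγ', hlt, hβι, hγι, (hlt.trans_le hγ').ne', hβ, ?_⟩
  -- The right side is `√2 · √2 = 2`, whereas `γ ≤ 2 sin θ < 2`.
  rw [hβ, ENNReal.toReal_ofReal (Real.sqrt_nonneg 2), Real.sq_sqrt zero_le_two,
    show (4 : ℝ) - 2 = 2 by norm_num, Real.mul_self_sqrt zero_le_two]
  refine (lt_of_le_of_lt (ENNReal.toReal_le_of_le_ofReal (by positivity) hγ) ?_).ne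
  nlinarith
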